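/- Let $M$ be a smooth connected closed manifold of dimension $n\ge 2$, let $W_1,W_2\subset M$ be nonempty open subsets, and fix $\alpha\in(0,1)$. For a smooth Riemannian metric $g$ on $M$ and $\beta\in(0,1)$, let $0<\lambda_{j_1}<\lambda_{j_2}<\cdots$ be the distinct positive eigenvalues of $-\Delta_g$, let $P_k$ be the orthogonal projection of $L^2(M)$ onto the eigenspace of $\lambda_{j_k}$, and let $P_{W_1,W_2,k}:=(P_k\circ e)|_{W_2}:L^2(W_1)\to L^2(W_2)$, where $e:L^2(W_1)\to L^2(M)$ is extension by zero. The fractional power is $(-\Delta_g)^\beta u=\sum_k\lambda_{j_k}^\beta P_ku$ on $H^{2\beta}(M)=\{u\in L^2(M):\sum_k\lambda_{j_k}^{2\beta}\|P_ku\|^2<\infty\}$. For $f\in C^2_c((0,\infty);L^2(W_1))$, extended by zero to $M$, let $u_f$ be the solution of $$i\partial_t^\alpha u+(-\Delta_g)^\beta u=f\ \text{ in } M\times(0,\infty),\qquad u(0)=0,$$ ($\partial_t^\alpha$ being the Caputo derivative) with $u\in C^1([0,\infty);H^{2\beta}(M))\cap L^\infty(0,\infty;H^{2\beta}(M))$ and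 $\partial_tu\in L^\infty(0,\infty;H^{2\beta}(M))$, and let $L^{\alpha,\beta}_{W_1,W_2}f=u_f|_{W_2\times(0,\infty)}$ be the source-to-solution map. Then $L^{\alpha,\beta}_{W_1,W_2}$ on $C^2_c((0,\infty);L^2(W_1))$ determines the operator-valued function $$H^\beta_{W_1,W_2}(s)=\sum_{k\ge1}\frac{1}{\lambda_{j_k}^\beta+is^\alpha}P_{W_1,W_2,k},\qquad \mathrm{Re}\,s>0.$$ That is, if $g,\tilde g$ are two smooth Riemannian metrics on $M$ and $\beta,\tilde\beta\in(0,1)$ are such that $L^{\alpha,\beta}_{W_1,W_2}f=\tilde L^{\alpha,\tilde\beta}_{W_1,W_2}f$ for all $f\in C^2_c((0,\infty);L^2(W_1))$, then for every $s$ with $\mathrm{Re}\,s>0$ the series defining $H^\beta_{W_1,W_2}(s)$ and $\tilde H^{\tilde\beta}_{W_1,W_2}(s)$ converge strongly to bounded operators $L^2(W_1)\to L^2(W_2)$, and $H^\beta_{W_1,W_2}(s)\xi=\tilde H^{\tilde\beta}_{W_1,W_2}(s)\xi$ on $W_2$ for all $\xi\in L^2(W_1)$. (As function spaces up to null sets,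 $L^2(W_1)$ and $L^2(W_2)$ do not depend on the metric.) -/

import Mathlib

open MeasureTheory Set
open scoped Manifold ContDiff ENNReal

noncomputable section

namespace FracSchrodinger

/-- Smooth Riemannian metrics on the smooth `n`-manifold `M` (without boundary). -/
abbrev SmoothMetric (n : ℕ) (M : Type*) [TopologicalSpace M]
    [ChartedSpace (EuclideanSpace ℝ (Fin n)) M] [IsManifold (𝓡 n) ∞ M] :=
  Bundle.ContMDiffRiemannianMetric (𝓡 n) ∞ (EuclideanSpace ℝ (Fin n))
    (fun x : M => TangentSpace (𝓡 n) x)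

section Geometry

variable {n : ℕ} {M : Type*} [TopologicalSpace M] [ChartedSpace (EuclideanSpace ℝ (Fin n)) M]
  [IsManifold (𝓡 n) ∞ M]

/-! ### Riemannian volume -/

/-- The coordinate vector field `∂ᵢ` of the preferred chart at `x`, at the point with
coordinates `y`. -/
def coordVec (x : M) (i : Fin n) (y : EuclideanSpace ℝ (Fin n)) :
    TangentSpace (𝓡 n) ((chartAt (EuclideanSpace ℝ (Fin n)) x).symm y) :=
  mfderiv 𝓘(ℝ, EuclideanSpace ℝ (Fin n)) (𝓡 n)
    (chartAt (EuclideanSpace ℝ (Fin n)) x).symm y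
    (EuclideanSpace.basisFun (Fin n) ℝ i : EuclideanSpace ℝ (Fin n))

/-- The matrix `(g_ij)` in the preferred chart at `x`, at the point with coordinates `y`. -/
def gramMatrix (g : SmoothMetric n M) (x : M) (y : EuclideanSpace ℝ (Fin n)) :
    Matrix (Fin n) (Fin n) ℝ :=
  Matrix.of fun i j =>
    g.inner ((chartAt (EuclideanSpace ℝ (Fin n)) x).symm y) (coordVec x i y) (coordVec x j y)

variable [MeasurableSpace M]

/-- The Riemannian volume `√det(g_ij) dy` of the domain of the preferred chart at `x`,
as a measure on `M` (which vanishes outside this domain). -/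
def chartVolume (g : SmoothMetric n M) (x : M) : Measure M :=
  (((volume : Measure (EuclideanSpace ℝ (Fin n))).restrict
      (chartAt (EuclideanSpace ℝ (Fin n)) x).target).withDensity
    (fun y => ENNReal.ofReal (Real.sqrt (gramMatrix g x y).det))).map
      (chartAt (EuclideanSpace ℝ (Fin n)) x).symm

/-- The Riemannian volume measure `dV_g`: the least measure that dominates the chart volumes.
By the change of variables formula, the chart volumes agree on overlaps of chart domains, so this
is the measure which restricts to `√det(g_ij) dy` on each chart domain. -/
def vol (g : SmoothMetric n M) : Measure M := ⨆ x : M, chartVolume g x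

end Geometry

section Gradient

variable {n : ℕ} {M : Type*} [TopologicalSpace M] [ChartedSpace (EuclideanSpace ℝ (Fin n)) M]
  [IsManifold (𝓡 n) ∞ M]

/-- A covector is represented by a tangent vector through the metric. -/
theorem exists_riesz (g : SmoothMetric n M) (p : M)
    (l : TangentSpace (𝓡 n) p →ₗ[ℝ] ℝ) :
    ∃ w : TangentSpace (𝓡 n) p, ∀ z, g.inner p w z = l z := by
  have : FiniteDimensional ℝ (TangentSpace (𝓡 n) p) :=
    inferInstanceAs (FiniteDimensional ℝ (EuclideanSpace ℝ (Fin n)))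
  let B : TangentSpace (𝓡 n) p →ₗ[ℝ] Module.Dual ℝ (TangentSpace (𝓡 n) p) :=
    { toFun := fun w => (g.inner p w).toLinearMap
      map_add' := fun a b => by ext z; simp
      map_smul' := fun c a => by ext z; simp }
  have hinj : Function.Injective B := by
    rw [← LinearMap.ker_eq_bot, LinearMap.ker_eq_bot']
    intro w hw
    by_contra hne
    have h1 := g.pos p w hne
    have h2 : g.inner p w w = 0 := by
      have := congrArg (fun f : Module.Dual ℝ (TangentSpace (𝓡 n) p) => f w) hw
      simpa [B] using this
    exact absurd h2 h1.ne'
  have hsurj : Function.Surjective B :=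
    (LinearMap.injective_iff_surjective_of_finrank_eq_finrank
      (Subspace.dual_finrank_eq (K := ℝ) (V := TangentSpace (𝓡 n) p)).symm).1 hinj
  obtain ⟨w, hw⟩ := hsurj l
  refine ⟨w, fun z => ?_⟩
  rw [← hw]
  rfl

/-- The Riemannian gradient of `u` at `p`: the tangent vector with `g_p(∇u(p), z) = du_p(z)` for
all tangent vectors `z`. -/
def grad (g : SmoothMetric n M) (u : M → ℝ) (p : M) : TangentSpace (𝓡 n) p :=
  (exists_riesz g p
    (show TangentSpace (𝓡 n) p →L[ℝ] ℝ from mfderiv (𝓡 n) 𝓘(ℝ, ℝ) u p).toLinearMap).choose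

variable [MeasurableSpace M]

/-- `-Δ_g u = h` for a smooth real function `u` on a closed manifold, where `-Δ_g = ∇* ∇` is the
Laplace-Beltrami operator:
`∫ g(∇u, ∇v) dV_g = ∫ h v dV_g` for all smooth real functions `v`. -/
def IsNegLaplacian (g : SmoothMetric n M) (u h : M → ℝ) : Prop :=
  ∀ v : M → ℝ, ContMDiff (𝓡 n) 𝓘(ℝ, ℝ) ∞ v →
    ∫ p, g.inner p (grad g u p) (grad g v p) ∂(vol g) = ∫ p, h p * v p ∂(vol g)

/-- `u` is a smooth complex function with `-Δ_g u = lam u` (`Δ_g` acts on the real and on the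
imaginary part). -/
def IsEigenfunction (g : SmoothMetric n M) (lam : ℝ) (u : M → ℂ) : Prop :=
  ContMDiff (𝓡 n) 𝓘(ℝ, ℂ) ∞ u ∧
    IsNegLaplacian g (fun p => (u p).re) (fun p => lam * (u p).re) ∧
    IsNegLaplacian g (fun p => (u p).im) (fun p => lam * (u p).im)

end Gradient

section Spectral

variable {n : ℕ} {M : Type*} [TopologicalSpace M] [ChartedSpace (EuclideanSpace ℝ (Fin n)) M]
  [IsManifold (𝓡 n) ∞ M] [MeasurableSpace M]

/-- The complex Hilbert space `L²(M)`. -/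
abbrev L2 (g : SmoothMetric n M) := Lp ℂ 2 (vol g)

/-- The complex Hilbert space `L²(W)`. -/
abbrev L2On (g : SmoothMetric n M) (W : Set M) := Lp ℂ 2 ((vol g).restrict W)

/-- The eigenspace of `-Δ_g` for `lam` in `L²(M)`: the closed linear span of the classes of the
eigenfunctions. (These classes already form a finite-dimensional subspace; taking the closed
span changes nothing.) -/
def eigenspace (g : SmoothMetric n M) (lam : ℝ) : Submodule ℂ (L2 g) :=
  (Submodule.span ℂ {x : L2 g | ∃ u : M → ℂ, IsEigenfunction g lam u ∧
    (x : M → ℂ) =ᵐ[vol g] u}).topologicalClosure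

instance (g : SmoothMetric n M) (lam : ℝ) : CompleteSpace (eigenspace g lam) :=
  Submodule.topologicalClosure.completeSpace _

/-- The orthogonal projection of `L²(M)` onto the eigenspace of `lam`. -/
def eigenproj (g : SmoothMetric n M) (lam : ℝ) : L2 g →L[ℂ] L2 g :=
  (eigenspace g lam).starProjection

/-- The set of the distinct positive eigenvalues of `-Δ_g`. -/
def posEigenvalues (g : SmoothMetric n M) : Set ℝ := {lam | 0 < lam ∧ eigenspace g lam ≠ ⊥}

/-- `u ∈ H^r(M)`, i.e. `∑ λ^r ‖P_λ u‖² < ∞`, the sum running over the distinct positive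
eigenvalues. -/
def MemSobolev (g : SmoothMetric n M) (r : ℝ) (u : L2 g) : Prop :=
  Summable fun lam : posEigenvalues g => (lam : ℝ) ^ r * ‖eigenproj g lam u‖ ^ 2

/-- The fractional Laplacian `(-Δ_g)^r u = ∑ λ^r P_λ u`, for `u ∈ H^{2r}(M)`. -/
def fracLaplacian (g : SmoothMetric n M) (r : ℝ) (u : L2 g) : L2 g :=
  ∑' lam : posEigenvalues g, (((lam : ℝ) ^ r : ℝ) : ℂ) • eigenproj g lam u

end Spectral

section Equation

/-- The Caputo derivative of order `α ∈ (0, 1)` of a `C¹` function `u` on `[0, ∞)`. -/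
def caputo {F : Type*} [NormedAddCommGroup F] [NormedSpace ℝ F] (α : ℝ) (u : ℝ → F) (t : ℝ) : F :=
  (Real.Gamma (1 - α))⁻¹ • ∫ τ in (0 : ℝ)..t, ((t - τ) ^ (-α)) • derivWithin u (Ici 0) τ

/-- `f ∈ C²_c((0, ∞); F)`, extended by zero to the real line. -/
def IsC2c {F : Type*} [NormedAddCommGroup F] [NormedSpace ℝ F] (f : ℝ → F) : Prop :=
  ContDiff ℝ 2 f ∧ HasCompactSupport f ∧ tsupport f ⊆ Ioi 0

variable {n : ℕ} {M : Type*} [TopologicalSpace M] [ChartedSpace (EuclideanSpace ℝ (Fin n)) M]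
  [IsManifold (𝓡 n) ∞ M] [MeasurableSpace M]

/-- `u` and `(-Δ_g)^β u` together; the space `H^{2β}(M)` carries the graph norm of
`(-Δ_g)^β`, so that regularity of `u` in `H^{2β}(M)` is regularity of this pair in
`L²(M) × L²(M)`. -/
def sobolevLift (g : SmoothMetric n M) (β : ℝ) (u : ℝ → L2 g) (t : ℝ) : L2 g × L2 g :=
  (u t, fracLaplacian g β (u t))

/-- `u` solves `i ∂_t^α u + (-Δ_g)^β u = f` in `M × (0, ∞)`, `u(0) = 0`, in the class
`u ∈ C¹([0, ∞); H^{2β}(M)) ∩ L^∞(0, ∞; H^{2β}(M))`, `∂_t u ∈ L^∞(0, ∞; H^{2β}(M))`.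
Only the values `u t` with `t ≥ 0` matter. -/
structure IsSolution (g : SmoothMetric n M) (α β : ℝ) (f u : ℝ → L2 g) : Prop where
  memSobolev : ∀ t, 0 ≤ t → MemSobolev g (2 * β) (u t)
  contDiffOn : ContDiffOn ℝ 1 (sobolevLift g β u) (Ici 0)
  bounded : ∃ C : ℝ, ∀ t, 0 ≤ t → ‖sobolevLift g β u t‖ ≤ C
  deriv_bounded : ∃ C : ℝ, ∀ t, 0 ≤ t → ‖derivWithin (sobolevLift g β u) (Ici 0) t‖ ≤ C
  init : u 0 = 0
  equation : ∀ t, 0 < t → Complex.I • caputo α u t + fracLaplacian g β (u t) = f t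

open Classical in
/-- The solution `u_f` with source `f` (`0` if there is none). -/
def solution (g : SmoothMetric n M) (α β : ℝ) (f : ℝ → L2 g) : ℝ → L2 g :=
  if h : ∃ u, IsSolution g α β f u then h.choose else 0

variable [BorelSpace M]

/-- Extension by zero `e : L²(W) → L²(M)`, for an open set `W`. -/
def zeroExt (g : SmoothMetric n M) (W : TopologicalSpace.Opens M) :
    L2On g (W : Set M) →L[ℂ] L2 g :=
  LinearMap.mkContinuous
    { toFun := fun x => MemLp.toLp ((W : Set M).indicator x)
        ((memLp_indicator_iff_restrict W.isOpen.measurableSet).2 (Lp.memLp x))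
      map_add' := fun x y => by
        rw [← MemLp.toLp_add, MemLp.toLp_eq_toLp_iff]
        have h := (ae_restrict_iff' W.isOpen.measurableSet).1 (Lp.coeFn_add x y)
        filter_upwards [h] with p hp
        by_cases hpW : p ∈ (W : Set M)
        · simpa [hpW] using hp hpW
        · simp [hpW]
      map_smul' := fun c x => by
        rw [RingHom.id_apply, ← MemLp.toLp_const_smul, MemLp.toLp_eq_toLp_iff]
        have h := (ae_restrict_iff' W.isOpen.measurableSet).1 (Lp.coeFn_smul c x)
        filter_upwards [h] with p hp
        by_cases hpW : p ∈ (W : Set M)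
        · simp [hpW, hp hpW]
        · simp [hpW] }
    1 (fun x => by
      rw [one_mul, LinearMap.coe_mk, AddHom.coe_mk, Lp.norm_toLp,
        eLpNorm_indicator_eq_eLpNorm_restrict W.isOpen.measurableSet, Lp.norm_def])

/-- Restriction `L²(M) → L²(W)`. -/
def restr (g : SmoothMetric n M) (W : TopologicalSpace.Opens M) :
    L2 g →L[ℂ] L2On g (W : Set M) :=
  LpToLpRestrictCLM M ℂ ℂ (vol g) 2 (W : Set M)

/-- The source-to-solution map `L^{α,β}_{W₁,W₂} f = u_f|_{W₂ × (0,∞)}`, where sources with values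
in `L²(W₁)` are extended by zero. -/
def sourceToSolution (g : SmoothMetric n M) (α β : ℝ) (W₁ W₂ : TopologicalSpace.Opens M)
    (f : ℝ → L2On g (W₁ : Set M)) : Ioi (0 : ℝ) → L2On g (W₂ : Set M) :=
  fun t => restr g W₂ (solution g α β (fun τ => zeroExt g W₁ (f τ)) t)

/-- The operator `P_{W₁,W₂,λ} = (P_λ ∘ e)|_{W₂}`. -/
def localProj (g : SmoothMetric n M) (W₁ W₂ : TopologicalSpace.Opens M) (lam : ℝ) :
    L2On g (W₁ : Set M) →L[ℂ] L2On g (W₂ : Set M) :=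
  restr g W₂ ∘L eigenproj g lam ∘L zeroExt g W₁

/-- The bounded operator `H : L²(W₁) → L²(W₂)` is the sum `∑ (λ^β + i s^α)⁻¹ P_{W₁,W₂,λ}` over the
distinct positive eigenvalues. -/
def IsSpectralSum (g : SmoothMetric n M) (α β : ℝ) (W₁ W₂ : TopologicalSpace.Opens M) (s : ℂ)
    (H : L2On g (W₁ : Set M) →L[ℂ] L2On g (W₂ : Set M)) : Prop :=
  ∀ ξ, HasSum (fun lam : posEigenvalues g =>
    ((((lam : ℝ) ^ β : ℝ) : ℂ) + Complex.I * s ^ (α : ℂ))⁻¹ • localProj g W₁ W₂ lam ξ) (H ξ)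

end Equation

/-- Two `L²`-classes, possibly for different measures, are classes of the same function. -/
def SameFun {M : Type*} [MeasurableSpace M] {μ ν : Measure M} (x : Lp ℂ 2 μ) (y : Lp ℂ 2 ν) :
    Prop :=
  (x : M → ℂ) =ᵐ[μ] y ∧ (x : M → ℂ) =ᵐ[ν] y

end FracSchrodinger

end

open FracSchrodinger

/-! Write `A = (-Δ_g)^β`, acting as `0` on the orthogonal complement of the positive eigenspaces,
and `z = i s^α`. For a source `φ(t) ξ` the Laplace transform turns the equation into `(z + A) û =
φ̂(s) ξ`, since the Caputo derivative becomes multiplication by `s^α`. For `Re s > 0` the number `z`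
lies in a closed subsector of the upper half-plane, away from `-λ^β`, so `û(s) = φ̂(s) (A + z)⁻¹ ξ`.
Choosing `φ` with `φ̂(s) ≠ 0`, the source-to-solution map determines `(A + z)⁻¹` from `W₁` to `W₂`.

This resolvent differs from `H(s)` by the zero mode `z⁻¹ (1 - P₊)`, where `P₊` projects onto the
closed span of the positive eigenspaces. Write `(A + z)⁻¹ = z⁻¹ (1 - A (A + z)⁻¹)`. The identity
between `W₁` and `W₂` does not depend on the metric, so `A (A + z)⁻¹` is determined too. Letting `s
→ 0+` it tends strongly to `P₊`, by the sector bound `|z| / Im z ≤ 1 / cos(πα/2)`. Hence `H(s) = z⁻¹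
(P₊ - A (A + z)⁻¹)` is determined.

Existence of a solution is needed, because `solution` is `0` otherwise; it comes from inverting the
Laplace transform along vertical lines (`exists_fractional_evolution`). Every solution has the
transform above (`laplace_fractional_evolution`), so it does not matter which one is chosen.
Equality across the two metrics is handled as membership in a closed subspace of `L² × L²`
(`isClosed_sameFunSubmodule`), which is possible because all Riemannian volumes have the same null
sets. Completeness of the eigenfunctions plays no role. -/

open Filter Topology

/-! ### Spectral multipliers for an orthogonal family of subspaces. -/

section Multiplier

variable {H : Type*} [NormedAddCommGroup H] [InnerProductSpace ℂ H]
  {ι : Type*} {V : ι → Submodule ℂ H} [∀ i, (V i).HasOrthogonalProjection]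

theorem starProjection_starProjection_of_ne
    (hV : OrthogonalFamily ℂ (fun i => V i) fun i => (V i).subtypeₗᵢ) {i j : ι} (hij : i ≠ j)
    (x : H) : (V i).starProjection ((V j).starProjection x) = 0 := by
  rw [Submodule.starProjection_apply_eq_zero_iff, Submodule.mem_orthogonal]
  intro u hu
  exact hV hij ⟨u, hu⟩ ⟨_, Submodule.starProjection_apply_mem (V j) x⟩

theorem norm_sq_sum_smul_starProjection
    (hV : OrthogonalFamily ℂ (fun i => V i) fun i => (V i).subtypeₗᵢ) (m : ι → ℂ) (x : H)
    (s : Finset ι) :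
    ‖∑ i ∈ s, m i • (V i).starProjection x‖ ^ 2
      = ∑ i ∈ s, ‖m i‖ ^ 2 * ‖(V i).starProjection x‖ ^ 2 := by
  have := hV.norm_sum (fun i => m i • (V i).orthogonalProjectionOnto x) s
  simp only [norm_smul, mul_pow] at this
  exact this

/-- Bessel's inequality. Pairing `x` with the partial sum of its projections gives the squared norm
of that sum; Cauchy-Schwarz then bounds it by `‖x‖` times its norm. -/
theorem sum_norm_sq_starProjection_le
    (hV : OrthogonalFamily ℂ (fun i => V i) fun i => (V i).subtypeₗᵢ) (x : H) (s : Finset ι) :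
    ∑ i ∈ s, ‖(V i).starProjection x‖ ^ 2 ≤ ‖x‖ ^ 2 := by
  have h1 := norm_sq_sum_smul_starProjection hV (fun _ => 1) x s
  simp only [one_smul, norm_one, one_pow, one_mul] at h1
  have h2 : RCLike.re (inner ℂ x (∑ i ∈ s, (V i).starProjection x) : ℂ)
      = ∑ i ∈ s, ‖(V i).starProjection x‖ ^ 2 := by
    rw [inner_sum, map_sum]
    refine Finset.sum_congr rfl fun i _ => ?_
    rw [← inner_conj_symm, RCLike.conj_re]
    exact Submodule.re_inner_starProjection_eq_normSq (V i) x
  have h3 := (RCLike.re_le_norm _).trans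
    (norm_inner_le_norm (𝕜 := ℂ) x (∑ i ∈ s, (V i).starProjection x))
  rw [h2, ← h1] at h3
  rw [← h1]
  nlinarith [norm_nonneg x, norm_nonneg (∑ i ∈ s, (V i).starProjection x)]

theorem summable_norm_sq_starProjection
    (hV : OrthogonalFamily ℂ (fun i => V i) fun i => (V i).subtypeₗᵢ) (x : H) :
    Summable fun i => ‖(V i).starProjection x‖ ^ 2 :=
  summable_of_sum_le (fun _ => by positivity) (sum_norm_sq_starProjection_le hV x)

theorem tsum_norm_sq_starProjection_le
    (hV : OrthogonalFamily ℂ (fun i => V i) fun i => (V i).subtypeₗᵢ) (x : H) :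
    ∑' i, ‖(V i).starProjection x‖ ^ 2 ≤ ‖x‖ ^ 2 :=
  (summable_norm_sq_starProjection hV x).tsum_le_of_sum_le (sum_norm_sq_starProjection_le hV x)

theorem norm_sq_mul_le_of_bound {m : ι → ℂ} {C : ℝ} (hm : ∀ i, ‖m i‖ ≤ C) (x : H) (i : ι) :
    ‖m i‖ ^ 2 * ‖(V i).starProjection x‖ ^ 2 ≤ C ^ 2 * ‖(V i).starProjection x‖ ^ 2 := by
  gcongr
  exact hm i

theorem summable_norm_sq_mul_of_bound
    (hV : OrthogonalFamily ℂ (fun i => V i) fun i => (V i).subtypeₗᵢ) {m : ι → ℂ} {C : ℝ}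
    (hm : ∀ i, ‖m i‖ ≤ C) (x : H) :
    Summable fun i => ‖m i‖ ^ 2 * ‖(V i).starProjection x‖ ^ 2 :=
  ((summable_norm_sq_starProjection hV x).mul_left (C ^ 2)).of_nonneg_of_le
    (fun _ => by positivity) (norm_sq_mul_le_of_bound hm x)

variable (V) in
/-- The operator which multiplies by `m i` on the `i`-th member of a family of subspaces. -/
noncomputable def spectralMul (m : ι → ℂ) (x : H) : H := ∑' i, m i • (V i).starProjection x

/-- The hypothesis `hy` expresses that `y` lies in the closed span of the family; only then do its
projections determine it. -/
theorem spectralMul_eq_of_starProjection_eq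
    {m : ι → ℂ} {x y : H} (hy : spectralMul V (fun _ => 1) y = y)
    (h : ∀ i, (V i).starProjection y = m i • (V i).starProjection x) :
    spectralMul V m x = y := by
  rw [← hy, spectralMul, spectralMul]
  simp only [one_smul, h]

variable [CompleteSpace H]

theorem summable_smul_starProjection
    (hV : OrthogonalFamily ℂ (fun i => V i) fun i => (V i).subtypeₗᵢ) {m : ι → ℂ} {x : H}
    (h : Summable fun i => ‖m i‖ ^ 2 * ‖(V i).starProjection x‖ ^ 2) :
    Summable fun i => m i • (V i).starProjection x := by
  have := (hV.summable_iff_norm_sq_summable (fun i => m i • (V i).orthogonalProjectionOnto x)).2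
  simp only [norm_smul, mul_pow] at this
  exact this h

theorem summable_smul_starProjection_of_bound
    (hV : OrthogonalFamily ℂ (fun i => V i) fun i => (V i).subtypeₗᵢ) {m : ι → ℂ} {C : ℝ}
    (hm : ∀ i, ‖m i‖ ≤ C) (x : H) : Summable fun i => m i • (V i).starProjection x :=
  summable_smul_starProjection hV (summable_norm_sq_mul_of_bound hV hm x)

theorem starProjection_spectralMul
    (hV : OrthogonalFamily ℂ (fun i => V i) fun i => (V i).subtypeₗᵢ) {m : ι → ℂ} {x : H}
    (h : Summable fun i => ‖m i‖ ^ 2 * ‖(V i).starProjection x‖ ^ 2) (j : ι) :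
    (V j).starProjection (spectralMul V m x) = m j • (V j).starProjection x := by
  rw [spectralMul, ContinuousLinearMap.map_tsum _ (summable_smul_starProjection hV h),
    tsum_eq_single j]
  · rw [map_smul, Submodule.starProjection_eq_self_iff.2 (Submodule.starProjection_apply_mem _ _)]
  · intro i hi
    rw [map_smul, starProjection_starProjection_of_ne hV hi.symm, smul_zero]

theorem norm_sq_spectralMul
    (hV : OrthogonalFamily ℂ (fun i => V i) fun i => (V i).subtypeₗᵢ) {m : ι → ℂ} {x : H}
    (h : Summable fun i => ‖m i‖ ^ 2 * ‖(V i).starProjection x‖ ^ 2) :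
    ‖spectralMul V m x‖ ^ 2 = ∑' i, ‖m i‖ ^ 2 * ‖(V i).starProjection x‖ ^ 2 := by
  have h1 := ((summable_smul_starProjection hV h).hasSum.norm.pow 2)
  have h2 := h.hasSum
  refine tendsto_nhds_unique (h1.congr fun s => ?_) h2
  exact norm_sq_sum_smul_starProjection hV m x s

theorem norm_spectralMul_le
    (hV : OrthogonalFamily ℂ (fun i => V i) fun i => (V i).subtypeₗᵢ) {m : ι → ℂ} {C : ℝ}
    (hC : 0 ≤ C) (hm : ∀ i, ‖m i‖ ≤ C) (x : H) : ‖spectralMul V m x‖ ≤ C * ‖x‖ := by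
  refine (sq_le_sq₀ (norm_nonneg _) (by positivity)).1 ?_
  rw [norm_sq_spectralMul hV (summable_norm_sq_mul_of_bound hV hm x), mul_pow]
  calc _ ≤ ∑' i, C ^ 2 * ‖(V i).starProjection x‖ ^ 2 :=
        (summable_norm_sq_mul_of_bound hV hm x).tsum_le_tsum (norm_sq_mul_le_of_bound hm x)
          ((summable_norm_sq_starProjection hV x).mul_left _)
    _ ≤ _ := by
        rw [tsum_mul_left]
        gcongr
        exact tsum_norm_sq_starProjection_le hV x

/-- By orthogonality the squared norm of the difference is `∑ |m a i - m₀ i|² ‖P_i x‖²`, and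
dominated convergence applies. The convergence is strong, not in operator norm. -/
theorem tendsto_spectralMul
    (hV : OrthogonalFamily ℂ (fun i => V i) fun i => (V i).subtypeₗᵢ) {α : Type*} {l : Filter α}
    {m : α → ι → ℂ} {m₀ : ι → ℂ} {C : ℝ} (hm : ∀ᶠ a in l, ∀ i, ‖m a i‖ ≤ C)
    (hm₀ : ∀ i, ‖m₀ i‖ ≤ C) (h : ∀ i, Tendsto (fun a => m a i) l (𝓝 (m₀ i))) (x : H) :
    Tendsto (fun a => spectralMul V (m a) x) l (𝓝 (spectralMul V m₀ x)) := by
  rw [tendsto_iff_norm_sub_tendsto_zero]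
  have key : Tendsto (fun a => ∑' i, ‖m a i - m₀ i‖ ^ 2 * ‖(V i).starProjection x‖ ^ 2) l
      (𝓝 (∑' _ : ι, 0)) := by
    refine tendsto_tsum_of_dominated_convergence
      ((summable_norm_sq_starProjection hV x).mul_left ((C + C) ^ 2)) (fun i => ?_) ?_
    · have := (((h i).sub_const (m₀ i)).norm.pow 2).mul_const (‖(V i).starProjection x‖ ^ 2)
      simpa using this
    · filter_upwards [hm] with a ha i
      rw [Real.norm_of_nonneg (by positivity)]
      gcongr
      exact (norm_sub_le _ _).trans (add_le_add (ha i) (hm₀ i))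
  rw [tsum_zero] at key
  have key2 := key.sqrt
  rw [Real.sqrt_zero] at key2
  refine key2.congr' ?_
  filter_upwards [hm] with a ha
  have hb : ∀ i, ‖(fun i => m a i - m₀ i) i‖ ≤ C + C := fun i =>
    (norm_sub_le _ _).trans (add_le_add (ha i) (hm₀ i))
  rw [← norm_sq_spectralMul hV (m := fun i => m a i - m₀ i)
    (summable_norm_sq_mul_of_bound hV hb x), Real.sqrt_sq (norm_nonneg _), spectralMul,
    spectralMul, spectralMul, ← (summable_smul_starProjection_of_bound hV ha x).tsum_sub
      (summable_smul_starProjection_of_bound hV hm₀ x)]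
  simp only [sub_smul]

/-- Boundedness is what allows a multiplier to be moved through vector-valued integrals. -/
theorem exists_clm_spectralMul
    (hV : OrthogonalFamily ℂ (fun i => V i) fun i => (V i).subtypeₗᵢ) {m : ι → ℂ} {C : ℝ}
    (hC : 0 ≤ C) (hm : ∀ i, ‖m i‖ ≤ C) : ∃ T : H →L[ℂ] H, ∀ x, T x = spectralMul V m x := by
  refine ⟨LinearMap.mkContinuous
    { toFun := spectralMul V m
      map_add' := fun x y => ?_
      map_smul' := fun c x => ?_ } C (norm_spectralMul_le hV hC hm), fun x => rfl⟩
  · simp only [spectralMul, map_add, smul_add]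
    exact (summable_smul_starProjection_of_bound hV hm x).tsum_add
      (summable_smul_starProjection_of_bound hV hm y)
  · simp only [spectralMul, map_smul, RingHom.id_apply, smul_comm _ c]
    exact (summable_smul_starProjection_of_bound hV hm x).tsum_const_smul c

theorem spectralMul_one_spectralMul
    (hV : OrthogonalFamily ℂ (fun i => V i) fun i => (V i).subtypeₗᵢ) {m : ι → ℂ} {x : H}
    (h : Summable fun i => ‖m i‖ ^ 2 * ‖(V i).starProjection x‖ ^ 2) :
    spectralMul V (fun _ => 1) (spectralMul V m x) = spectralMul V m x := by
  conv_lhs => rw [spectralMul]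
  simp only [one_smul, starProjection_spectralMul hV h]
  rfl

end Multiplier

/-! ### The Laplace transform, of powers and of Caputo derivatives. -/

section Laplace

variable {F : Type*} [NormedAddCommGroup F] [NormedSpace ℂ F]

/-- The Laplace transform of a function on the half-line. -/
noncomputable def laplace (f : ℝ → F) (s : ℂ) : F := ∫ t in Ioi (0 : ℝ), Complex.exp (-(s * t)) • f t

theorem norm_exp_neg_mul_ofReal (s : ℂ) (t : ℝ) :
    ‖Complex.exp (-(s * t))‖ = Real.exp (-(s.re * t)) := by
  simp [Complex.norm_exp]

theorem integrableOn_exp_neg_mul_smul {f : ℝ → F} {C : ℝ} (hf : ContinuousOn f (Ioi 0))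
    (hC : ∀ t, 0 < t → ‖f t‖ ≤ C) {s : ℂ} (hs : 0 < s.re) :
    IntegrableOn (fun t : ℝ => Complex.exp (-(s * t)) • f t) (Ioi 0) := by
  have h1 : IntegrableOn (fun t : ℝ => C * Real.exp (-(s.re * t))) (Ioi 0) := by
    have := (integrableOn_exp_mul_Ioi (a := -s.re) (by linarith) 0).const_mul C
    simp only [neg_mul] at this
    exact this
  refine Integrable.mono' h1 ?_ ?_
  · refine ContinuousOn.aestronglyMeasurable (ContinuousOn.smul ?_ hf) measurableSet_Ioi
    exact Continuous.continuousOn (by fun_prop)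
  · filter_upwards [ae_restrict_mem measurableSet_Ioi] with t ht
    rw [norm_smul, norm_exp_neg_mul_ofReal, mul_comm]
    gcongr
    exact hC t ht

theorem differentiableAt_laplace {f : ℝ → F}
    (hf : ∀ s : ℂ, 0 < s.re → IntegrableOn (fun t : ℝ => Complex.exp (-(s * t)) • f t) (Ioi 0))
    {s : ℂ} (hs : 0 < s.re) : DifferentiableAt ℂ (laplace f) s := by
  have hs4 : 0 < ((s.re / 4 : ℝ) : ℂ).re := by simp; linarith
  have key := hasDerivAt_integral_of_dominated_loc_of_deriv_le (𝕜 := ℂ) (E := F)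
    (μ := volume.restrict (Ioi (0 : ℝ)))
    (F := fun s t => Complex.exp (-(s * t)) • f t)
    (F' := fun s t => (-(t : ℂ) * Complex.exp (-(s * t))) • f t) (x₀ := s)
    (s := {z | s.re / 2 < z.re})
    (bound := fun t => (4 / s.re) * ‖Complex.exp (-(((s.re / 4 : ℝ) : ℂ) * t)) • f t‖)
    ((isOpen_lt continuous_const Complex.continuous_re).mem_nhds (by simp; linarith))
    ?_ (hf s hs) ?_ ?_ ((hf _ hs4).norm.const_mul _) ?_
  · exact key.2.differentiableAt
  · filter_upwards [(isOpen_lt continuous_const Complex.continuous_re).mem_nhds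
      (show (0 : ℝ) < s.re from hs)] with z hz
    exact (hf z hz).aestronglyMeasurable
  · have := (hf s hs).aestronglyMeasurable
    simp_rw [mul_smul]
    refine AEStronglyMeasurable.smul ?_ this
    exact Continuous.aestronglyMeasurable (by fun_prop)
  · filter_upwards [ae_restrict_mem measurableSet_Ioi] with t ht z hz
    have ht : 0 < t := ht
    have hz : s.re / 2 < z.re := hz
    rw [norm_smul, norm_smul, norm_mul, norm_exp_neg_mul_ofReal, norm_exp_neg_mul_ofReal, norm_neg,
      Complex.norm_real, Real.norm_of_nonneg ht.le, Complex.ofReal_re, ← mul_assoc]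
    refine mul_le_mul_of_nonneg_right ?_ (norm_nonneg _)
    -- Half of the available decay `exp (-(Re s / 2) t)` absorbs the factor `t` created by
    -- differentiation; the other half keeps the bound integrable.
    have h1 : t ≤ 4 / s.re * Real.exp (s.re / 4 * t) := by
      have := Real.add_one_le_exp (s.re / 4 * t)
      have h2 : t = 4 / s.re * (s.re / 4 * t) := by field_simp
      calc t = 4 / s.re * (s.re / 4 * t) := h2
        _ ≤ _ := by gcongr; linarith
    calc t * Real.exp (-(z.re * t))
        ≤ (4 / s.re * Real.exp (s.re / 4 * t)) * Real.exp (-(s.re / 2 * t)) := by gcongr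
      _ = _ := by rw [mul_assoc, ← Real.exp_add]; ring_nf
  · filter_upwards with t z _
    have h1 : HasDerivAt (fun z : ℂ => -(z * t)) (-(t : ℂ)) z := by
      simpa using ((hasDerivAt_id z).mul_const (t : ℂ)).fun_neg
    have := h1.cexp.smul_const (f t)
    simpa [mul_comm] using this

theorem integrableOn_exp_neg_mul_rpow {α : ℝ} (hα : α < 1) {s : ℂ} (hs : 0 < s.re) :
    IntegrableOn (fun t : ℝ => Complex.exp (-(s * t)) • ((t ^ (-α) : ℝ) : ℂ)) (Ioi 0) := by
  have h := integrableOn_rpow_mul_exp_neg_mul_rpow (s := -α) (p := 1) (by linarith) one_pos hs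
  refine Integrable.mono' h ?_ ?_
  · have : Continuous fun t : ℝ => Complex.exp (-(s * t)) := by fun_prop
    refine this.aestronglyMeasurable.smul ?_
    exact Measurable.aestronglyMeasurable (by fun_prop)
  · filter_upwards [ae_restrict_mem measurableSet_Ioi] with t ht
    have ht : 0 < t := ht
    rw [norm_smul, norm_exp_neg_mul_ofReal, Complex.norm_real, Real.norm_of_nonneg (by positivity),
      Real.rpow_one, mul_comm, neg_mul]

/-- On positive reals this is the Gamma integral; both sides are holomorphic in the right
half-plane, so the identity theorem extends it. -/
theorem laplace_rpow {α : ℝ} (hα : α < 1) {s : ℂ} (hs : 0 < s.re) :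
    laplace (fun t : ℝ => ((t ^ (-α) : ℝ) : ℂ)) s
      = (Real.Gamma (1 - α) : ℂ) * s ^ ((α : ℂ) - 1) := by
  have hU : IsOpen {z : ℂ | 0 < z.re} := isOpen_lt continuous_const Complex.continuous_re
  have h1 : AnalyticOnNhd ℂ (laplace (fun t : ℝ => ((t ^ (-α) : ℝ) : ℂ))) {z : ℂ | 0 < z.re} :=
    DifferentiableOn.analyticOnNhd (fun z hz => (differentiableAt_laplace
      (fun s hs => integrableOn_exp_neg_mul_rpow hα hs) hz).differentiableWithinAt) hU
  have h2 : AnalyticOnNhd ℂ (fun s : ℂ => (Real.Gamma (1 - α) : ℂ) * s ^ ((α : ℂ) - 1))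
      {z : ℂ | 0 < z.re} := by
    refine DifferentiableOn.analyticOnNhd (fun z hz => ?_) hU
    have hz' : z ∈ Complex.slitPlane := Or.inl hz
    exact ((differentiableAt_id.cpow_const hz').const_mul _).differentiableWithinAt
  have hreal : ∀ r : ℝ, 0 < r → laplace (fun t : ℝ => ((t ^ (-α) : ℝ) : ℂ)) r
      = (Real.Gamma (1 - α) : ℂ) * (r : ℂ) ^ ((α : ℂ) - 1) := by
    intro r hr
    have h := Complex.integral_cpow_mul_exp_neg_mul_Ioi (a := 1 - α) (r := r) (by simpa using hα) hr
    have hr0 : (r : ℂ) ≠ 0 := by exact_mod_cast hr.ne'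
    rw [laplace, ← Complex.Gamma_ofReal, mul_comm]
    push_cast
    have h3 : (1 / (r : ℂ)) ^ (1 - (α : ℂ)) = (r : ℂ) ^ ((α : ℂ) - 1) := by
      rw [one_div, Complex.inv_cpow _ _ (by
        rw [Complex.arg_ofReal_of_nonneg hr.le]; exact Real.pi_pos.ne), ← Complex.cpow_neg,
        neg_sub]
    rw [← h3, ← h]
    refine setIntegral_congr_fun measurableSet_Ioi fun t ht => ?_
    have ht : 0 < t := ht
    simp only [smul_eq_mul]
    rw [Complex.ofReal_cpow ht.le, mul_comm]
    congr 2
    push_cast; ring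
  refine h1.eqOn_of_preconnected_of_frequently_eq h2
    (convex_halfSpace_re_gt 0).isPreconnected (z₀ := 1) (by simp) ?_ hs
  -- The points `1 + 1/(n+1)` are real, differ from `1` and accumulate there.
  have hseq : Tendsto (fun n : ℕ => (((1 + 1 / ((n : ℝ) + 1) : ℝ)) : ℂ)) atTop (𝓝[≠] 1) := by
    refine tendsto_nhdsWithin_iff.2 ⟨?_, Eventually.of_forall fun n => ?_⟩
    · have := (tendsto_one_div_add_atTop_nhds_zero_nat (𝕜 := ℝ)).const_add 1
      rw [add_zero] at this
      have h2 := (Complex.continuous_ofReal.tendsto _).comp this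
      rw [Complex.ofReal_one] at h2
      exact h2
    · have : (0 : ℝ) < 1 / ((n : ℝ) + 1) := by positivity
      intro h
      have h := congrArg Complex.re h
      simp only [Complex.ofReal_re, Complex.one_re] at h
      linarith
  exact hseq.frequently (Frequently.of_forall fun n => hreal _ (by positivity))

variable [CompleteSpace F]

theorem laplace_deriv {u u' : ℝ → F} {C C' : ℝ} (hu : ContinuousOn u (Ici 0))
    (hd : ∀ t, 0 < t → HasDerivAt u (u' t) t) (hu' : ContinuousOn u' (Ioi 0))
    (hC : ∀ t, 0 < t → ‖u t‖ ≤ C) (hC' : ∀ t, 0 < t → ‖u' t‖ ≤ C') {s : ℂ} (hs : 0 < s.re) :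
    laplace u' s = s • laplace u s - u 0 := by
  have i1 := integrableOn_exp_neg_mul_smul (hu.mono Ioi_subset_Ici_self) hC hs
  have i2 := integrableOn_exp_neg_mul_smul hu' hC' hs
  have key := integral_Ioi_of_hasDerivAt_of_tendsto (a := 0) (m := (0 : F))
    (f := fun t : ℝ => Complex.exp (-(s * t)) • u t)
    (f' := fun t : ℝ => Complex.exp (-(s * t)) • u' t - s • (Complex.exp (-(s * t)) • u t))
    ?_ ?_ (i2.sub (i1.smul s)) ?_
  · have i3 : IntegrableOn (fun t : ℝ => s • (Complex.exp (-(s * t)) • u t)) (Ioi 0) := i1.smul s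
    rw [integral_sub i2 i3, integral_smul] at key
    simp only [Complex.ofReal_zero, mul_zero, neg_zero, Complex.exp_zero, one_smul, zero_sub] at key
    rw [laplace, laplace, sub_eq_iff_eq_add.1 key]
    abel
  · have : Continuous fun t : ℝ => Complex.exp (-(s * t)) := by fun_prop
    exact this.continuousWithinAt.smul (hu 0 self_mem_Ici)
  · intro t ht
    have h1 : HasDerivAt (fun t : ℝ => -(s * (t : ℂ))) (-s) t := by
      simpa using ((hasDerivAt_id t).ofReal_comp.const_mul s).fun_neg
    have := h1.cexp.fun_smul (hd t ht)
    convert this using 1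
    rw [sub_eq_add_neg, ← neg_smul, smul_smul]
    congr 2
    ring
  · refine squeeze_zero_norm' (a := fun t => Real.exp (-(s.re * t)) * C) ?_ ?_
    · filter_upwards [eventually_gt_atTop 0] with t ht
      rw [norm_smul, norm_exp_neg_mul_ofReal]
      gcongr
      exact hC t ht
    · have : Tendsto (fun t : ℝ => Real.exp (-(s.re * t))) atTop (𝓝 0) :=
        Real.tendsto_exp_neg_atTop_nhds_zero.comp (tendsto_id.const_mul_atTop hs)
      simpa using this.mul_const C

open FracSchrodinger in
-- The Caputo derivative is the convolution of `u'` with `t^(-α) / Γ(1 - α)`. The transforms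
-- multiply to `s û · s^(α-1)`, the boundary term vanishing as `u 0 = 0`.
theorem laplace_caputo {α : ℝ} (hα : α ∈ Ioo (0 : ℝ) 1) {u : ℝ → F} {C C' : ℝ}
    (hu : ContDiffOn ℝ 1 u (Ici 0)) (hu0 : u 0 = 0)
    (hC : ∀ t, 0 ≤ t → ‖u t‖ ≤ C) (hC' : ∀ t, 0 ≤ t → ‖derivWithin u (Ici 0) t‖ ≤ C')
    {s : ℂ} (hs : 0 < s.re) :
    IntegrableOn (fun t : ℝ => Complex.exp (-(s * t)) • caputo α u t) (Ioi 0) ∧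
      laplace (caputo α u) s = s ^ (α : ℂ) • laplace u s := by
  have hs0 : s ≠ 0 := by rintro rfl; simp at hs
  have hd : ContinuousOn (derivWithin u (Ici 0)) (Ici 0) :=
    hu.continuousOn_derivWithin (uniqueDiffOn_Ici 0) le_rfl
  have hd' := hd.mono Ioi_subset_Ici_self
  have hlap : laplace (derivWithin u (Ici 0)) s = s • laplace u s := by
    rw [laplace_deriv hu.continuousOn (fun t ht => ?_) hd' (fun t ht => hC t ht.le)
      (fun t ht => hC' t ht.le) hs, hu0, sub_zero]
    exact ((hu.differentiableOn one_ne_zero t ht.le).hasDerivWithinAt).hasDerivAt (Ici_mem_nhds ht)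
  have i1 := integrableOn_exp_neg_mul_smul hd' (fun t ht => hC' t ht.le) hs
  have i2 := integrableOn_exp_neg_mul_rpow hα.2 hs
  let L : F →L[ℝ] ℂ →L[ℝ] F := (ContinuousLinearMap.lsmul ℝ ℂ).flip
  -- Splitting `e^(-st) = e^(-sτ) e^(-s(t-τ))` gives a convolution of two integrable functions, so
  -- Fubini applies.
  have hker : ∀ t : ℝ, Complex.exp (-(s * t)) • caputo α u t = (Real.Gamma (1 - α))⁻¹ •
      ∫ τ in (0 : ℝ)..t, L (Complex.exp (-(s * τ)) • derivWithin u (Ici 0) τ)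
        (Complex.exp (-(s * ((t - τ : ℝ) : ℂ))) • (((t - τ) ^ (-α) : ℝ) : ℂ)) := by
    intro t
    rw [caputo, smul_comm, ← intervalIntegral.integral_smul]
    congr 2
    ext τ
    simp only [L, ContinuousLinearMap.flip_apply, ContinuousLinearMap.lsmul_apply]
    rw [smul_eq_mul, smul_smul, ← Complex.coe_smul ((t - τ) ^ (-α)), smul_smul]
    congr 1
    rw [mul_right_comm, ← Complex.exp_add]
    congr 2
    push_cast
    ring
  have hG : Real.Gamma (1 - α) ≠ 0 := (Real.Gamma_pos_of_pos (by linarith [hα.2])).ne'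
  constructor
  · have h := (integrable_posConvolution i1 i2 L).integrableOn (s := Ioi 0)
    have h2 := h.smul ((Real.Gamma (1 - α))⁻¹)
    refine h2.congr ?_
    filter_upwards [ae_restrict_mem measurableSet_Ioi] with t ht
    rw [hker t, Pi.smul_apply, posConvolution, indicator_of_mem ht]
  · rw [laplace]
    simp_rw [hker]
    rw [integral_smul, integral_posConvolution i1 i2 L]
    have h3 := laplace_rpow hα.2 hs
    rw [laplace] at h3 hlap
    rw [h3, hlap]
    simp only [L, ContinuousLinearMap.flip_apply, ContinuousLinearMap.lsmul_apply]
    rw [← Complex.coe_smul, smul_smul, smul_smul]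
    congr 1
    rw [Complex.cpow_sub _ _ hs0, Complex.cpow_one]
    have : (Real.Gamma (1 - α) : ℂ) ≠ 0 := by exact_mod_cast hG
    push_cast
    field_simp

end Laplace

/-! ### Inverse Laplace transforms along vertical lines. -/

section Bromwich

/-- The model for the decay along vertical lines of the functions to be integrated. -/
noncomputable def lineBound (α y : ℝ) : ℝ := (1 + |y| ^ (-α)) / (1 + y ^ 2)

theorem lineBound_nonneg (α y : ℝ) : 0 ≤ lineBound α y := by
  rw [lineBound]; positivity

/-- Near `0` the singularity `|y|^(-α)` is integrable since `α < 1`; away from it the bound is `2 /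
(1 + y²)`. The singularity leaves room for the factor `z⁻¹ = (i s^α)⁻¹`. -/
theorem integrable_lineBound {α : ℝ} (hα : α ∈ Ioo (0 : ℝ) 1) : Integrable (lineBound α) := by
  have h1 : IntegrableOn (fun y : ℝ => |y| ^ (-α)) (Icc (-1) 1) := by
    have h0 : IntervalIntegrable (fun y : ℝ => |y| ^ (-α)) volume 0 1 := by
      refine (intervalIntegral.intervalIntegrable_rpow' (a := 0) (b := 1) (r := -α)
        (by linarith [hα.2])).congr ?_
      intro y hy
      rw [uIoc_of_le zero_le_one] at hy
      simp only [abs_of_pos hy.1]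
    have h0' : IntervalIntegrable (fun y : ℝ => |y| ^ (-α)) volume (-1) 0 := by
      have := (IntervalIntegrable.iff_comp_neg (f := fun y : ℝ => |y| ^ (-α)) (a := 0)
        (b := 1)).1 h0
      simpa using this.symm
    rw [integrableOn_Icc_iff_integrableOn_Ioc]
    exact (intervalIntegrable_iff_integrableOn_Ioc_of_le (by norm_num)).1 (h0'.trans h0)
  rw [← integrable_indicator_iff measurableSet_Icc] at h1
  refine ((integrable_inv_one_add_sq.const_mul 2).add h1).mono' ?_ ?_
  · exact Measurable.aestronglyMeasurable (by unfold lineBound; fun_prop)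
  · filter_upwards with y
    rw [Real.norm_of_nonneg (lineBound_nonneg α y), lineBound, Pi.add_apply]
    have hp : 0 < 1 + y ^ 2 := by positivity
    have hr : 0 ≤ |y| ^ (-α) := by positivity
    by_cases hy : y ∈ Icc (-1 : ℝ) 1
    · rw [indicator_of_mem hy, add_div]
      refine add_le_add ?_ (div_le_self hr (by nlinarith [sq_nonneg y]))
      rw [one_div]
      linarith [inv_pos.2 hp]
    · rw [indicator_of_notMem hy, add_zero, div_eq_mul_inv]
      gcongr
      have h2 : 1 ≤ |y| := by
        by_contra h
        exact hy (abs_le.1 (not_le.1 h).le)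
      have := Real.rpow_le_one_of_one_le_of_nonpos h2 (by linarith [hα.1] : -α ≤ 0)
      linarith

theorem tendsto_lineBound {α : ℝ} (hα : α ∈ Ioo (0 : ℝ) 1) : Tendsto (lineBound α) atTop (𝓝 0) := by
  have h1 : Tendsto (fun y : ℝ => 2 * y⁻¹) atTop (𝓝 0) := by
    simpa using tendsto_inv_atTop_zero.const_mul (2 : ℝ)
  refine squeeze_zero' (Eventually.of_forall (lineBound_nonneg α)) ?_ h1
  filter_upwards [eventually_ge_atTop 1] with y hy
  have hy0 : 0 < y := by linarith
  have := Real.rpow_le_one_of_one_le_of_nonpos (hy.trans (le_abs_self y))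
    (by linarith [hα.1] : -α ≤ 0)
  rw [lineBound, div_le_iff₀ (by positivity)]
  have h3 : 2 ≤ 2 * y⁻¹ * (1 + y ^ 2) := by
    have : 2 * y⁻¹ * (1 + y ^ 2) = 2 * y⁻¹ + 2 * y := by field_simp
    rw [this]
    have := inv_pos.2 hy0
    linarith
  linarith

theorem lineBound_neg (α y : ℝ) : lineBound α (-y) = lineBound α y := by
  simp [lineBound]

variable {E : Type*} [NormedAddCommGroup E] [NormedSpace ℂ E]

/-- Functions which can be integrated along all vertical lines in the right half-plane. -/
structure IsBromwich (α : ℝ) (K : ℝ) (F : ℂ → E) : Prop where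
  nonneg : 0 ≤ K
  differentiableAt : ∀ s : ℂ, 0 < s.re → DifferentiableAt ℂ F s
  bound : ∀ s : ℂ, 0 < s.re → s.im ≠ 0 → ‖F s‖ ≤ K * lineBound α s.im

/-- The integral `∫ e^{st} F(s) dy` along the line `s = σ + i y`. -/
noncomputable def bromwich (σ : ℝ) (F : ℂ → E) (t : ℝ) : E :=
  ∫ y : ℝ, Complex.exp (((σ : ℂ) + y * Complex.I) * t) • F (σ + y * Complex.I)

theorem norm_exp_line (σ y t : ℝ) :
    ‖Complex.exp (((σ : ℂ) + y * Complex.I) * t)‖ = Real.exp (σ * t) := by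
  simp [Complex.norm_exp]

variable {α K : ℝ} {F : ℂ → E}

theorem IsBromwich.continuous_line (h : IsBromwich α K F) {σ : ℝ} (hσ : 0 < σ) :
    Continuous fun y : ℝ => F (σ + y * Complex.I) := by
  rw [continuous_iff_continuousAt]
  intro y
  have h1 := (h.differentiableAt (σ + y * Complex.I) (by simpa using hσ)).continuousAt
  exact ContinuousAt.comp (f := fun y : ℝ => ((σ : ℂ) + y * Complex.I)) h1
    (Continuous.continuousAt (by fun_prop))

theorem IsBromwich.norm_le_line (h : IsBromwich α K F) {σ : ℝ} (hσ : 0 < σ) :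
    ∀ᵐ y : ℝ, ‖F (σ + y * Complex.I)‖ ≤ K * lineBound α y := by
  have : ∀ᵐ y : ℝ, y ≠ 0 := by simp [ae_iff]
  filter_upwards [this] with y hy
  simpa using h.bound (σ + y * Complex.I) (by simpa using hσ) (by simpa using hy)

theorem IsBromwich.integrable_line (h : IsBromwich α K F) (hα : α ∈ Ioo (0 : ℝ) 1) {σ : ℝ}
    (hσ : 0 < σ) : Integrable fun y : ℝ => F (σ + y * Complex.I) :=
  ((integrable_lineBound hα).const_mul K).mono' (h.continuous_line hσ).aestronglyMeasurable
    (h.norm_le_line hσ)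

theorem IsBromwich.integrable (h : IsBromwich α K F) (hα : α ∈ Ioo (0 : ℝ) 1) {σ : ℝ}
    (hσ : 0 < σ) (t : ℝ) :
    Integrable fun y : ℝ =>
      Complex.exp (((σ : ℂ) + y * Complex.I) * t) • F (σ + y * Complex.I) := by
  refine ((h.integrable_line hα hσ).norm.const_mul (Real.exp (σ * t))).mono' ?_ ?_
  · exact (Continuous.smul (by fun_prop) (h.continuous_line hσ)).aestronglyMeasurable
  · filter_upwards with y
    rw [norm_smul, norm_exp_line]

theorem IsBromwich.norm_bromwich_le (h : IsBromwich α K F) (hα : α ∈ Ioo (0 : ℝ) 1) {σ : ℝ}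
    (hσ : 0 < σ) (t : ℝ) :
    ‖bromwich σ F t‖ ≤ Real.exp (σ * t) * (K * ∫ y, lineBound α y) := by
  rw [← integral_const_mul, ← integral_const_mul]
  refine norm_integral_le_of_norm_le (((integrable_lineBound hα).const_mul K).const_mul _) ?_
  filter_upwards [h.norm_le_line hσ] with y hy
  rw [norm_smul, norm_exp_line]
  gcongr

/-- Cauchy's theorem on the rectangle `[σ, σ'] × [-R, R]`: the horizontal sides vanish as `R → ∞`
because `lineBound` decays. -/
theorem IsBromwich.bromwich_eq_of_lt (h : IsBromwich α K F) (hα : α ∈ Ioo (0 : ℝ) 1) {σ σ' : ℝ}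
    (hσ : 0 < σ) (hσ' : σ < σ') (t : ℝ) : bromwich σ F t = bromwich σ' F t := by
  let f : ℂ → E := fun s => Complex.exp (s * t) • F s
  have hf : ∀ s : ℂ, 0 < s.re → DifferentiableAt ℂ f s := fun s hs =>
    DifferentiableAt.smul (by fun_prop) (h.differentiableAt s hs)
  have hrect : ∀ R : ℝ, (((∫ x : ℝ in σ..σ', f (x + (-R : ℝ) * Complex.I)) -
      ∫ x : ℝ in σ..σ', f (x + R * Complex.I)) +
      Complex.I • ∫ y : ℝ in (-R)..R, f (σ' + y * Complex.I)) -
      Complex.I • ∫ y : ℝ in (-R)..R, f (σ + y * Complex.I) = 0 := by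
    intro R
    have := Complex.integral_boundary_rect_eq_zero_of_differentiableOn f
      (σ + (-R : ℝ) * Complex.I) (σ' + R * Complex.I) ?_
    · simpa using this
    · intro s hs
      refine (hf s ?_).differentiableWithinAt
      have := hs.1
      simp only [mem_preimage, Complex.add_re, Complex.ofReal_re, Complex.mul_re, Complex.I_re,
        mul_zero, Complex.ofReal_im, Complex.I_im, mul_one, sub_self, add_zero,
        uIcc_of_le hσ'.le] at this
      linarith [this.1]
  have hbd : ∀ R : ℝ, R ≠ 0 → ‖∫ x : ℝ in σ..σ', f (x + R * Complex.I)‖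
      ≤ Real.exp (σ' * |t|) * (K * lineBound α R) * |σ' - σ| := by
    intro R hR
    refine intervalIntegral.norm_integral_le_of_norm_le_const fun x hx => ?_
    rw [uIoc_of_le hσ'.le] at hx
    have hx0 : 0 < x := hσ.trans hx.1
    rw [norm_smul, norm_exp_line]
    have h1 := h.bound (x + R * Complex.I) (by simpa using hx0) (by simpa using hR)
    simp only [Complex.add_im, Complex.ofReal_im, Complex.mul_im, Complex.ofReal_re, Complex.I_im,
      mul_one, Complex.I_re, mul_zero, add_zero, zero_add] at h1
    refine mul_le_mul (Real.exp_le_exp.2 ?_) h1 (norm_nonneg _) (Real.exp_pos _).le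
    calc x * t ≤ x * |t| := by gcongr; exact le_abs_self t
      _ ≤ σ' * |t| := by gcongr; exact hx.2
  have hb0 : Tendsto (fun R : ℝ => Real.exp (σ' * |t|) * (K * lineBound α R) * |σ' - σ|) atTop
      (𝓝 0) := by
    simpa using (((tendsto_lineBound hα).const_mul K).const_mul (Real.exp (σ' * |t|))).mul_const
      |σ' - σ|
  have hz1 : Tendsto (fun R : ℝ => ∫ x : ℝ in σ..σ', f (x + R * Complex.I)) atTop (𝓝 0) := by
    refine squeeze_zero_norm' ?_ hb0
    filter_upwards [eventually_gt_atTop 0] with R hR using hbd R hR.ne'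
  have hz2 : Tendsto (fun R : ℝ => ∫ x : ℝ in σ..σ', f (x + (-R : ℝ) * Complex.I)) atTop
      (𝓝 0) := by
    refine squeeze_zero_norm' ?_ hb0
    filter_upwards [eventually_gt_atTop 0] with R hR
    have := hbd (-R) (neg_ne_zero.2 hR.ne')
    rwa [lineBound_neg] at this
  have hv : ∀ σ : ℝ, 0 < σ → Tendsto (fun R : ℝ => Complex.I • ∫ y : ℝ in (-R)..R,
      f (σ + y * Complex.I)) atTop (𝓝 (Complex.I • bromwich σ F t)) := fun σ hσ =>
    (intervalIntegral_tendsto_integral (h.integrable hα hσ t) tendsto_neg_atTop_atBot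
      tendsto_id).const_smul _
  have hlim := ((hz2.sub hz1).add (hv σ' (hσ.trans hσ'))).sub (hv σ hσ)
  simp only [hrect] at hlim
  have := tendsto_nhds_unique hlim tendsto_const_nhds
  rw [sub_self, zero_add, ← smul_sub, smul_eq_zero, sub_eq_zero] at this
  exact (this.resolve_left Complex.I_ne_zero).symm

theorem IsBromwich.bromwich_eq (h : IsBromwich α K F) (hα : α ∈ Ioo (0 : ℝ) 1) {σ σ' : ℝ}
    (hσ : 0 < σ) (hσ' : 0 < σ') (t : ℝ) : bromwich σ F t = bromwich σ' F t := by
  rcases lt_trichotomy σ σ' with h1 | rfl | h1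
  · exact h.bromwich_eq_of_lt hα hσ h1 t
  · rfl
  · exact (h.bromwich_eq_of_lt hα hσ' h1 t).symm

/-- The bound in `IsBromwich` is uniform in `Re s`, so the line may be pushed to `σ → 0+`, where the
growth factor `e^(σt)` disappears. -/
theorem IsBromwich.norm_bromwich_le_const (h : IsBromwich α K F) (hα : α ∈ Ioo (0 : ℝ) 1)
    (t : ℝ) : ‖bromwich 1 F t‖ ≤ K * ∫ y, lineBound α y := by
  have h1 : Tendsto (fun σ : ℝ => Real.exp (σ * t) * (K * ∫ y, lineBound α y)) (𝓝[>] 0)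
      (𝓝 (Real.exp (0 * t) * (K * ∫ y, lineBound α y))) := by
    refine (Continuous.tendsto ?_ 0).mono_left nhdsWithin_le_nhds
    fun_prop
  rw [zero_mul, Real.exp_zero, one_mul] at h1
  refine ge_of_tendsto h1 ?_
  filter_upwards [self_mem_nhdsWithin] with σ hσ
  rw [h.bromwich_eq hα one_pos hσ t]
  exact h.norm_bromwich_le hα hσ t

/-- Causality: for `t < 0` pushing the line to `σ → ∞` makes `e^(σt)` tend to `0`. -/
theorem IsBromwich.bromwich_of_neg (h : IsBromwich α K F) (hα : α ∈ Ioo (0 : ℝ) 1) {t : ℝ}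
    (ht : t < 0) : bromwich 1 F t = 0 := by
  have h1 : Tendsto (fun σ : ℝ => Real.exp (σ * t) * (K * ∫ y, lineBound α y)) atTop (𝓝 0) := by
    have := Real.tendsto_exp_atBot.comp (tendsto_id.atTop_mul_const_of_neg ht)
    simpa using this.mul_const (K * ∫ y, lineBound α y)
  refine norm_le_zero_iff.1 (ge_of_tendsto h1 ?_)
  filter_upwards [eventually_gt_atTop 0] with σ hσ
  rw [h.bromwich_eq hα one_pos hσ t]
  exact h.norm_bromwich_le hα hσ t

theorem IsBromwich.hasDerivAt_bromwich {K' : ℝ} (h : IsBromwich α K F)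
    (h' : IsBromwich α K' fun s => s • F s) (hα : α ∈ Ioo (0 : ℝ) 1) (t : ℝ) :
    HasDerivAt (bromwich 1 F) (bromwich 1 (fun s => s • F s) t) t := by
  refine (hasDerivAt_integral_of_dominated_loc_of_deriv_le (𝕜 := ℝ) (μ := volume)
    (F := fun (t y : ℝ) => Complex.exp ((((1 : ℝ) : ℂ) + y * Complex.I) * t)
      • F ((1 : ℝ) + y * Complex.I))
    (F' := fun (t y : ℝ) => Complex.exp ((((1 : ℝ) : ℂ) + y * Complex.I) * t)
      • (((1 : ℝ) : ℂ) + y * Complex.I) • F ((1 : ℝ) + y * Complex.I)) (x₀ := t)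
    (s := Iio (t + 1))
    (bound := fun y : ℝ => Real.exp (t + 1) *
      ‖(((1 : ℝ) : ℂ) + y * Complex.I) • F ((1 : ℝ) + y * Complex.I)‖)
    (Iio_mem_nhds (by linarith)) (Eventually.of_forall fun x =>
      (h.integrable hα one_pos x).aestronglyMeasurable) (h.integrable hα one_pos t)
    (h'.integrable hα one_pos t).aestronglyMeasurable (Eventually.of_forall fun y x hx => ?_)
    ((h'.integrable_line hα one_pos).norm.const_mul _) (Eventually.of_forall fun y x _ => ?_)).2
  · rw [norm_smul, norm_exp_line, one_mul]
    gcongr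
    exact (mem_Iio.1 hx).le
  · have h1 : HasDerivAt (fun t : ℝ => (((1 : ℝ) : ℂ) + y * Complex.I) * t)
        (((1 : ℝ) : ℂ) + y * Complex.I) x := by
      simpa using (hasDerivAt_id x).ofReal_comp.const_mul (((1 : ℝ) : ℂ) + y * Complex.I)
    rw [smul_smul]
    exact h1.cexp.smul_const _

theorem IsBromwich.bromwich_zero {K' : ℝ} (h : IsBromwich α K F)
    (h' : IsBromwich α K' fun s => s • F s) (hα : α ∈ Ioo (0 : ℝ) 1) : bromwich 1 F 0 = 0 := by
  have h1 : Tendsto (bromwich 1 F) (𝓝[<] 0) (𝓝 (bromwich 1 F 0)) :=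
    (h.hasDerivAt_bromwich h' hα 0).continuousAt.tendsto.mono_left nhdsWithin_le_nhds
  refine tendsto_nhds_unique h1 (tendsto_const_nhds.congr' ?_)
  filter_upwards [self_mem_nhdsWithin] with t ht
  exact (h.bromwich_of_neg hα ht).symm

/-- The Abel integral of an inverse Laplace transform. -/
theorem IsBromwich.integral_rpow_smul_bromwich [CompleteSpace E] (h : IsBromwich α K F)
    (hα : α ∈ Ioo (0 : ℝ) 1) {t : ℝ} (ht : 0 ≤ t) :
    ∫ τ in (0 : ℝ)..t, ((t - τ) ^ (-α)) • bromwich 1 F τ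
      = Real.Gamma (1 - α) • bromwich 1 (fun s => s ^ ((α : ℂ) - 1) • F s) t := by
  have e1 := intervalIntegral.integral_comp_sub_left (a := 0) (b := t)
    (fun τ => ((t - τ) ^ (-α)) • bromwich 1 F τ) t
  rw [sub_zero, sub_self] at e1
  rw [← e1, intervalIntegral.integral_of_le ht, integral_Ioc_eq_integral_Ioo]
  simp only [sub_sub_cancel]
  -- By causality the integrand vanishes for `r > t`, so the range extends to the whole half-line.
  have e2 : ∫ r in Ioo 0 t, r ^ (-α) • bromwich 1 F (t - r)
      = ∫ r in Ioi (0 : ℝ), r ^ (-α) • bromwich 1 F (t - r) := by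
    rw [← integral_Ioc_eq_integral_Ioo]
    symm
    refine setIntegral_eq_of_subset_of_forall_sdiff_eq_zero measurableSet_Ioi
      (fun r hr => hr.1) fun r hr => ?_
    have : t < r := by
      by_contra hc
      exact hr.2 ⟨hr.1, not_lt.1 hc⟩
    rw [h.bromwich_of_neg hα (by linarith), smul_zero]
  rw [e2]
  have hint := (h.integrable hα one_pos t)
  have hre : ∀ y : ℝ, 0 < (((1 : ℝ) : ℂ) + y * Complex.I).re := fun y => by simp
  -- With `s = 1 + iy`, the factor `e^(-sr)` is split into `e^(-r)`, which makes `r^(-α)`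
  -- integrable, and a factor of modulus one. After Fubini the `r`-integral is the transform of
  -- `r^(-α)` at `s`.
  have e3 : ∀ r : ℝ, r ^ (-α) • bromwich 1 F (t - r) = ∫ y : ℝ,
      Complex.exp (-(r * y * Complex.I)) • ((Complex.exp (-(r : ℂ)) • ((r ^ (-α) : ℝ) : ℂ)) •
      (Complex.exp ((((1 : ℝ) : ℂ) + y * Complex.I) * t) • F ((1 : ℝ) + y * Complex.I))) := by
    intro r
    rw [bromwich, ← integral_smul]
    congr 1
    ext y
    rw [← Complex.coe_smul, smul_smul, smul_smul, smul_smul, smul_eq_mul]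
    congr 1
    rw [mul_comm (Complex.exp (-(r : ℂ))), mul_left_comm, mul_assoc, mul_assoc, ← Complex.exp_add,
      ← Complex.exp_add]
    congr 2
    push_cast
    ring
  have i1 : Integrable (fun r : ℝ => Complex.exp (-(r : ℂ)) • ((r ^ (-α) : ℝ) : ℂ))
      (volume.restrict (Ioi 0)) := by
    have := integrableOn_exp_neg_mul_rpow hα.2 (s := 1) (by simp)
    simp only [one_mul] at this
    exact this
  have i2 := i1.smul_prod hint
  have i3 : Integrable (fun p : ℝ × ℝ => Complex.exp (-(p.1 * p.2 * Complex.I)) •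
      ((Complex.exp (-(p.1 : ℂ)) • ((p.1 ^ (-α) : ℝ) : ℂ)) •
      (Complex.exp ((((1 : ℝ) : ℂ) + p.2 * Complex.I) * t) • F ((1 : ℝ) + p.2 * Complex.I))))
      ((volume.restrict (Ioi 0)).prod volume) := by
    refine i2.norm.mono' (AEStronglyMeasurable.smul (Continuous.aestronglyMeasurable (by fun_prop))
      i2.aestronglyMeasurable) (Eventually.of_forall fun p => ?_)
    rw [norm_smul, Complex.norm_exp]
    simp
  simp_rw [e3]
  rw [integral_integral_swap i3, bromwich, ← integral_smul]
  congr 1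
  ext y
  simp_rw [← smul_assoc]
  rw [integral_smul_const, integral_smul_const]
  have e4 := laplace_rpow hα.2 (hre y)
  rw [laplace] at e4
  have e5 : ∫ r in Ioi (0 : ℝ), (Complex.exp (-(r * y * Complex.I)) • Complex.exp (-(r : ℂ)))
      • ((r ^ (-α) : ℝ) : ℂ) = (Real.Gamma (1 - α) : ℂ) *
        (((1 : ℝ) : ℂ) + y * Complex.I) ^ ((α : ℂ) - 1) := by
    rw [← e4]
    congr 1
    ext r
    simp only [smul_eq_mul]
    rw [← Complex.exp_add]
    congr 2
    push_cast
    ring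
  rw [e5, ← Complex.coe_smul]
  congr 1
  simp only [smul_eq_mul]
  ring

end Bromwich

/-! ### Scalar test functions: decay, inversion and non-vanishing of their transforms. -/

section TestFunction

/-- Smooth functions with compact support in `(0, ∞)`. -/
structure IsTestFunction (φ : ℝ → ℂ) : Prop where
  contDiff : ContDiff ℝ ∞ φ
  hasCompactSupport : HasCompactSupport φ
  tsupport_subset : tsupport φ ⊆ Ioi 0

variable {φ : ℝ → ℂ}

theorem IsTestFunction.deriv (h : IsTestFunction φ) : IsTestFunction (deriv φ) :=
  ⟨(contDiff_infty_iff_deriv.1 h.contDiff).2, h.hasCompactSupport.deriv,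
    tsupport_deriv_subset.trans h.tsupport_subset⟩

theorem IsTestFunction.apply_eq_zero (h : IsTestFunction φ) {t : ℝ} (ht : t ≤ 0) : φ t = 0 := by
  by_contra hne
  exact not_lt.2 ht (h.tsupport_subset (subset_tsupport _ hne))

theorem IsTestFunction.integrable (h : IsTestFunction φ) : Integrable φ :=
  h.contDiff.continuous.integrable_of_hasCompactSupport h.hasCompactSupport

theorem IsTestFunction.laplace_deriv (h : IsTestFunction φ) {s : ℂ} (hs : 0 < s.re) :
    laplace (_root_.deriv φ) s = s * laplace φ s := by
  obtain ⟨C, hC⟩ := h.hasCompactSupport.exists_bound_of_continuous h.contDiff.continuous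
  obtain ⟨C', hC'⟩ := h.deriv.hasCompactSupport.exists_bound_of_continuous
    h.deriv.contDiff.continuous
  have := _root_.laplace_deriv (u := φ) (u' := _root_.deriv φ) h.contDiff.continuous.continuousOn
    (fun t _ => (h.contDiff.differentiable (by simp) t).hasDerivAt)
    h.deriv.contDiff.continuous.continuousOn (fun t _ => hC t) (fun t _ => hC' t) hs
  rw [this, h.apply_eq_zero le_rfl, sub_zero, smul_eq_mul]

theorem IsTestFunction.integrableOn_exp (h : IsTestFunction φ) (s : ℂ) (hs : 0 < s.re) :
    IntegrableOn (fun t : ℝ => Complex.exp (-(s * t)) • φ t) (Ioi 0) := by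
  obtain ⟨C, hC⟩ := h.hasCompactSupport.exists_bound_of_continuous h.contDiff.continuous
  exact integrableOn_exp_neg_mul_smul h.contDiff.continuous.continuousOn (fun t _ => hC t) hs

theorem IsTestFunction.norm_laplace_le (h : IsTestFunction φ) {s : ℂ} (hs : 0 < s.re) :
    ‖laplace φ s‖ ≤ ∫ t in Ioi (0 : ℝ), ‖φ t‖ := by
  refine norm_integral_le_of_norm_le h.integrable.norm.integrableOn ?_
  filter_upwards [ae_restrict_mem measurableSet_Ioi] with t ht
  have ht : 0 < t := ht
  rw [norm_smul, norm_exp_neg_mul_ofReal]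
  refine mul_le_of_le_one_left (norm_nonneg _) (Real.exp_le_one_iff.2 ?_)
  have := mul_pos hs ht
  linarith

/-- Since `s² φ̂` is the transform of `φ''`, the constant is the sum of the `L¹` norms of `φ` and
`φ''`. -/
theorem IsTestFunction.exists_norm_laplace_le (h : IsTestFunction φ) :
    ∃ K, 0 ≤ K ∧ ∀ s : ℂ, 0 < s.re → ‖laplace φ s‖ ≤ K / (1 + s.im ^ 2) := by
  refine ⟨(∫ t in Ioi (0 : ℝ), ‖φ t‖) + ∫ t in Ioi (0 : ℝ), ‖_root_.deriv (_root_.deriv φ) t‖,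
    by positivity, fun s hs => ?_⟩
  rw [le_div_iff₀ (by positivity)]
  have h1 := h.norm_laplace_le hs
  have h2 := h.deriv.deriv.norm_laplace_le hs
  rw [h.deriv.laplace_deriv hs, h.laplace_deriv hs, norm_mul, norm_mul, ← mul_assoc] at h2
  have h3 : s.im ^ 2 ≤ ‖s‖ * ‖s‖ := by
    rw [← sq, ← sq_abs]
    gcongr
    exact Complex.abs_im_le_norm s
  nlinarith [norm_nonneg (laplace φ s)]

variable {E : Type*} [NormedAddCommGroup E] [NormedSpace ℂ E]

/-- The quadratic decay of `φ̂` makes integrable any holomorphic factor with the growth of a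
resolvent at `i s^α`. -/
theorem IsTestFunction.exists_isBromwich (h : IsTestFunction φ) {α C : ℝ} (hα : α ∈ Ioo (0 : ℝ) 1)
    {G : ℂ → E} (hd : ∀ s : ℂ, 0 < s.re → DifferentiableAt ℂ G s)
    (hG : ∀ s : ℂ, 0 < s.re → ‖G s‖ ≤ C * (1 + ‖s‖ ^ (-α))) :
    ∃ K, IsBromwich α K fun s => laplace φ s • G s := by
  obtain ⟨K, hK, hb⟩ := h.exists_norm_laplace_le
  have hC : 0 ≤ C := by
    have := (norm_nonneg _).trans (hG 1 (by simp))
    simp only [norm_one, Real.one_rpow] at this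
    linarith
  refine ⟨K * C, by positivity, fun s hs =>
    (differentiableAt_laplace h.integrableOn_exp hs).smul (hd s hs), fun s hs hs' => ?_⟩
  rw [norm_smul, lineBound]
  calc ‖laplace φ s‖ * ‖G s‖ ≤ (K / (1 + s.im ^ 2)) * (C * (1 + |s.im| ^ (-α))) := by
        refine mul_le_mul (hb s hs) ((hG s hs).trans ?_) (norm_nonneg _) (by positivity)
        refine mul_le_mul_of_nonneg_left (add_le_add_right ?_ 1) hC
        exact Real.rpow_le_rpow_of_nonpos (abs_pos.2 hs') (Complex.abs_im_le_norm s)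
          (by linarith [hα.1])
    _ = _ := by ring

/-- On the line `Re s = 1` the Laplace transform of `φ` is, up to scaling, the Fourier transform of
`e^(-t) φ(t)`, and Fourier inversion applies. -/
theorem IsTestFunction.bromwich_laplace (h : IsTestFunction φ) (t : ℝ) :
    bromwich 1 (laplace φ) t = ((2 * Real.pi : ℝ) : ℂ) * φ t := by
  -- Any exponent in `(0, 1)` would do; only integrability on the line is wanted.
  obtain ⟨K, hB⟩ := h.exists_isBromwich (α := 1 / 2) (C := 1) (by norm_num) (G := fun _ => (1 : ℂ))
    (fun s _ => differentiableAt_const _) (fun s _ => by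
      rw [norm_one, one_mul]
      have : 0 ≤ ‖s‖ ^ (-(1 / 2 : ℝ)) := by positivity
      linarith)
  simp only [smul_eq_mul, mul_one] at hB
  let f : ℝ → ℂ := fun t => Complex.exp (-(t : ℂ)) * φ t
  have hfc : Continuous f := Continuous.mul (by fun_prop) h.contDiff.continuous
  have hfi : Integrable f := hfc.integrable_of_hasCompactSupport h.hasCompactSupport.mul_left
  have hF : FourierTransform.fourier f
      = fun x : ℝ => laplace φ ((1 : ℝ) + ((2 * Real.pi * x : ℝ) : ℂ) * Complex.I) := by
    ext x
    rw [Real.fourier_eq', laplace, ← integral_indicator measurableSet_Ioi]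
    congr 1
    ext v
    by_cases hv : v ∈ Ioi (0 : ℝ)
    · rw [indicator_of_mem hv]
      simp only [f, smul_eq_mul]
      rw [← mul_assoc, ← Complex.exp_add]
      congr 2
      simp only [RCLike.inner_apply, conj_trivial]
      push_cast
      ring
    · rw [indicator_of_notMem hv]
      simp only [f]
      rw [h.apply_eq_zero (not_lt.1 hv), mul_zero, smul_zero]
  have h2π : (2 * Real.pi) ≠ 0 := by positivity
  have hFi : Integrable (FourierTransform.fourier f) := by
    rw [hF]
    exact (hB.integrable_line (by norm_num) one_pos).comp_mul_left' h2π
  have key := hfi.fourierInv_fourier_eq hFi hfc.continuousAt (v := t)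
  rw [hF, Real.fourierInv_eq'] at key
  have hsub := Measure.integral_comp_mul_left (fun y : ℝ => Complex.exp ((y * t : ℝ) * Complex.I) *
    laplace φ ((1 : ℝ) + (y : ℂ) * Complex.I)) (2 * Real.pi)
  have e1 : ∫ x : ℝ, Complex.exp (((2 * Real.pi * inner ℝ x t : ℝ) : ℂ) * Complex.I) •
      laplace φ ((1 : ℝ) + ((2 * Real.pi * x : ℝ) : ℂ) * Complex.I)
      = ∫ x : ℝ, Complex.exp (((2 * Real.pi * x) * t : ℝ) * Complex.I) *
    laplace φ ((1 : ℝ) + ((2 * Real.pi * x : ℝ) : ℂ) * Complex.I) := by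
    congr 1
    ext x
    simp only [RCLike.inner_apply, conj_trivial, smul_eq_mul]
    congr 3
    push_cast
    ring
  rw [e1, hsub] at key
  have e2 : bromwich 1 (laplace φ) t = Complex.exp t * ∫ y : ℝ, Complex.exp ((y * t : ℝ) *
      Complex.I) * laplace φ ((1 : ℝ) + (y : ℂ) * Complex.I) := by
    rw [bromwich, ← integral_const_mul]
    congr 1
    ext y
    rw [smul_eq_mul, ← mul_assoc, ← Complex.exp_add]
    congr 2
    push_cast
    ring
  rw [abs_of_pos (by positivity), ← Complex.coe_smul, smul_eq_mul] at key
  rw [e2, (by rw [← key, ← mul_assoc, ← Complex.ofReal_mul, mul_inv_cancel₀ h2π, Complex.ofReal_one,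
    one_mul] : ∫ y : ℝ, Complex.exp ((y * t : ℝ) * Complex.I) *
      laplace φ ((1 : ℝ) + (y : ℂ) * Complex.I) = ((2 * Real.pi : ℝ) : ℂ) * f t)]
  simp only [f]
  rw [mul_left_comm, ← mul_assoc (Complex.exp t), ← Complex.exp_add, add_neg_cancel,
    Complex.exp_zero, one_mul]

/-- For every point of the right half-plane there is a test function whose Laplace transform does
not vanish there. -/
theorem exists_isTestFunction_laplace_ne_zero (s : ℂ) :
    ∃ φ, IsTestFunction φ ∧ laplace φ s ≠ 0 := by
  let b : ContDiffBump (2 : ℝ) := ⟨1 / 2, 1, by norm_num, by norm_num⟩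
  have hsupp : tsupport (fun t => b t) ⊆ Ioi 0 := by
    rw [b.tsupport_eq]
    intro t ht
    have := abs_le.1 (by simpa [Real.dist_eq] using ht : |t - 2| ≤ b.rOut)
    have h1 : b.rOut = 1 := rfl
    rw [h1] at this
    exact mem_Ioi.2 (by linarith [this.1])
  -- The factor `e^(st)` cancels the Laplace kernel, so the transform at `s` is the integral of the
  -- bump.
  refine ⟨fun t => Complex.exp (s * t) * (b t : ℂ), ⟨?_, ?_, ?_⟩, ?_⟩
  · refine ContDiff.mul ?_ ?_
    · exact (contDiff_const.mul Complex.ofRealCLM.contDiff).cexp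
    · exact Complex.ofRealCLM.contDiff.comp b.contDiff
  · refine HasCompactSupport.mul_left ?_
    exact b.hasCompactSupport.comp_left (g := fun x : ℝ => (x : ℂ)) Complex.ofReal_zero
  · refine (closure_mono fun t ht => ?_).trans hsupp
    simp only [Function.mem_support] at ht ⊢
    intro h0
    exact ht (by rw [h0, Complex.ofReal_zero, mul_zero])
  · have : laplace (fun t : ℝ => Complex.exp (s * t) * (b t : ℂ)) s = ((∫ t, b t : ℝ) : ℂ) := by
      rw [laplace, ← integral_complex_ofReal, ← integral_indicator measurableSet_Ioi]
      congr 1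
      ext t
      by_cases ht : t ∈ Ioi (0 : ℝ)
      · rw [indicator_of_mem ht, smul_eq_mul, ← mul_assoc, ← Complex.exp_add, neg_add_cancel,
          Complex.exp_zero, one_mul]
      · rw [indicator_of_notMem ht]
        have : b t = 0 := by
          by_contra hne
          exact ht (hsupp (subset_tsupport _ hne))
        rw [this, Complex.ofReal_zero]
    rw [this]
    exact_mod_cast b.integral_pos.ne'

end TestFunction

/-! ### Sector estimates for `z = i s^α`. -/

section Symbol

/-- As `|arg s| ≤ π/2`, the power `s^α` stays in the sector of half-angle `πα/2 < π/2`; thus `i s^α`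
keeps a definite angle from the real axis. -/
theorem re_cpow_ge {α : ℝ} (hα : α ∈ Ioo (0 : ℝ) 1) {s : ℂ} (hs : 0 < s.re) :
    Real.cos (Real.pi / 2 * α) * ‖s‖ ^ α ≤ (s ^ (α : ℂ)).re := by
  rw [Complex.cpow_ofReal_re, mul_comm]
  gcongr
  rw [← Real.cos_abs (s.arg * α), abs_mul, abs_of_pos hα.1]
  have h1 : |s.arg| ≤ Real.pi / 2 := Complex.abs_arg_le_pi_div_two_iff.2 hs.le
  refine Real.cos_le_cos_of_nonneg_of_le_pi (by have := hα.1; positivity) ?_ ?_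
  · nlinarith [Real.pi_pos, hα.1, hα.2]
  · exact mul_le_mul_of_nonneg_right h1 hα.1.le

theorem cos_pi_div_two_mul_pos {α : ℝ} (hα : α ∈ Ioo (0 : ℝ) 1) :
    0 < Real.cos (Real.pi / 2 * α) := by
  refine Real.cos_pos_of_mem_Ioo ⟨?_, ?_⟩ <;> nlinarith [Real.pi_pos, hα.1, hα.2]

theorem im_I_mul_cpow_pos {α : ℝ} (hα : α ∈ Ioo (0 : ℝ) 1) {s : ℂ} (hs : 0 < s.re) :
    0 < (Complex.I * s ^ (α : ℂ)).im := by
  have h0 : s ≠ 0 := by rintro rfl; simp at hs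
  have h1 := re_cpow_ge hα hs
  have h2 := cos_pi_div_two_mul_pos hα
  have h3 : 0 < ‖s‖ ^ α := Real.rpow_pos_of_pos (norm_pos_iff.2 h0) _
  simp only [Complex.mul_im, Complex.I_re, Complex.I_im, zero_mul, one_mul, zero_add]
  exact lt_of_lt_of_le (by positivity) h1

/-- This bound does not depend on `s`, which is what permits the limit `s → 0`. -/
theorem norm_I_mul_cpow_div_im_le {α : ℝ} (hα : α ∈ Ioo (0 : ℝ) 1) {s : ℂ} (hs : 0 < s.re) :
    ‖Complex.I * s ^ (α : ℂ)‖ / (Complex.I * s ^ (α : ℂ)).im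
      ≤ (Real.cos (Real.pi / 2 * α))⁻¹ := by
  have h0 : s ≠ 0 := by rintro rfl; simp at hs
  have h1 := re_cpow_ge hα hs
  have h2 := cos_pi_div_two_mul_pos hα
  rw [div_le_iff₀ (im_I_mul_cpow_pos hα hs), inv_mul_eq_div, le_div_iff₀ h2, norm_mul,
    Complex.norm_I, one_mul, Complex.norm_cpow_real, mul_comm]
  simpa using h1

variable {a : ℝ} {z : ℂ}

theorem im_le_norm_ofReal_add : z.im ≤ ‖(a : ℂ) + z‖ := by
  have := Complex.abs_im_le_norm ((a : ℂ) + z)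
  simp only [Complex.add_im, Complex.ofReal_im, zero_add] at this
  exact (le_abs_self _).trans this

theorem ofReal_add_ne_zero (hz : 0 < z.im) : (a : ℂ) + z ≠ 0 :=
  norm_pos_iff.1 (hz.trans_le (im_le_norm_ofReal_add))

theorem norm_inv_ofReal_add_le (hz : 0 < z.im) : ‖((a : ℂ) + z)⁻¹‖ ≤ z.im⁻¹ := by
  rw [norm_inv]
  exact inv_anti₀ hz (im_le_norm_ofReal_add)

/-- Writing `a / (a + z) = 1 - z / (a + z)` gives a bound independent of `a`, hence uniform over an
unbounded spectrum. -/
theorem norm_ofReal_div_add_le (hz : 0 < z.im) :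
    ‖(a : ℂ) / ((a : ℂ) + z)‖ ≤ 1 + ‖z‖ / z.im := by
  have h : (a : ℂ) / ((a : ℂ) + z) = 1 - z * ((a : ℂ) + z)⁻¹ := by
    have := ofReal_add_ne_zero (a := a) hz
    field_simp
    ring
  rw [h]
  refine (norm_sub_le _ _).trans ?_
  rw [norm_one, norm_mul, div_eq_mul_inv]
  gcongr
  exact norm_inv_ofReal_add_le hz

end Symbol

/-! ### The operator `A (A + z)⁻¹` and its holomorphy in `z`. -/

section Resolvent

variable {H : Type*} [NormedAddCommGroup H] [InnerProductSpace ℂ H] [CompleteSpace H]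
  {ι : Type*} {V : ι → Submodule ℂ H} [∀ i, (V i).HasOrthogonalProjection]

variable (V) in
/-- `A (A + z)⁻¹`, where `A` is the operator with eigenspaces `V i` and eigenvalues `a i`. -/
noncomputable def resolventMul (a : ι → ℝ) (z : ℂ) (x : H) : H :=
  spectralMul V (fun i => (a i : ℂ) / ((a i : ℂ) + z)) x

variable {a : ι → ℝ}

theorem starProjection_resolventMul
    (hV : OrthogonalFamily ℂ (fun i => V i) fun i => (V i).subtypeₗᵢ) {z : ℂ} (hz : 0 < z.im)
    (x : H) (i : ι) : (V i).starProjection (resolventMul V a z x)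
      = ((a i : ℂ) / ((a i : ℂ) + z)) • (V i).starProjection x :=
  starProjection_spectralMul hV
    (summable_norm_sq_mul_of_bound hV (fun _ => norm_ofReal_div_add_le hz) x) i

theorem spectralMul_one_resolventMul
    (hV : OrthogonalFamily ℂ (fun i => V i) fun i => (V i).subtypeₗᵢ) {z : ℂ} (hz : 0 < z.im)
    (x : H) : spectralMul V (fun _ => 1) (resolventMul V a z x) = resolventMul V a z x :=
  spectralMul_one_spectralMul hV
    (summable_norm_sq_mul_of_bound hV (fun _ => norm_ofReal_div_add_le hz) x)

theorem norm_resolventMul_le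
    (hV : OrthogonalFamily ℂ (fun i => V i) fun i => (V i).subtypeₗᵢ) {z : ℂ} (hz : 0 < z.im)
    (x : H) : ‖resolventMul V a z x‖ ≤ (1 + ‖z‖ / z.im) * ‖x‖ :=
  norm_spectralMul_le hV (by positivity) (fun _ => norm_ofReal_div_add_le hz) x

/-- The difference quotient is the multiplier `-a / ((a + z)(a + w))`, bounded uniformly in `a`
while `Im w > Im z / 2`, so `tendsto_spectralMul` gives the limit. -/
theorem differentiableAt_resolventMul
    (hV : OrthogonalFamily ℂ (fun i => V i) fun i => (V i).subtypeₗᵢ) {z : ℂ} (hz : 0 < z.im)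
    (x : H) : DifferentiableAt ℂ (fun z => resolventMul V a z x) z := by
  have hev : ∀ᶠ w : ℂ in 𝓝 z, z.im / 2 < w.im :=
    (isOpen_lt continuous_const Complex.continuous_im).mem_nhds (by simp; linarith)
  have hb : ∀ w : ℂ, z.im / 2 < w.im → ∀ i,
      ‖-((a i : ℂ) / ((a i : ℂ) + z)) * ((a i : ℂ) + w)⁻¹‖
        ≤ (1 + ‖z‖ / z.im) * (z.im / 2)⁻¹ := by
    intro w hw i
    rw [norm_mul, norm_neg]
    gcongr
    · exact norm_ofReal_div_add_le hz
    · exact (norm_inv_ofReal_add_le (by linarith)).trans (inv_anti₀ (by linarith) hw.le)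
  have key : HasDerivAt (fun z => resolventMul V a z x)
      (spectralMul V (fun i => -((a i : ℂ) / ((a i : ℂ) + z)) * ((a i : ℂ) + z)⁻¹) x) z := by
    rw [hasDerivAt_iff_tendsto_slope]
    have h1 : Tendsto (fun w => spectralMul V
        (fun i => -((a i : ℂ) / ((a i : ℂ) + z)) * ((a i : ℂ) + w)⁻¹) x) (𝓝[≠] z)
        (𝓝 (spectralMul V (fun i => -((a i : ℂ) / ((a i : ℂ) + z)) * ((a i : ℂ) + z)⁻¹) x)) := by
      refine (tendsto_spectralMul hV (C := (1 + ‖z‖ / z.im) * (z.im / 2)⁻¹) ?_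
        (hb z (by linarith)) (fun i => ?_) x).mono_left nhdsWithin_le_nhds
      · filter_upwards [hev] with w hw using hb w hw
      · exact ((tendsto_id.const_add _).inv₀ (ofReal_add_ne_zero hz)).const_mul _
    refine h1.congr' ?_
    filter_upwards [nhdsWithin_le_nhds hev, self_mem_nhdsWithin] with w hw hne
    have hw0 : 0 < w.im := by linarith
    have hsub : w - z ≠ 0 := sub_ne_zero.2 hne
    rw [slope_def_module, resolventMul, resolventMul, spectralMul, spectralMul, spectralMul,
      ← (summable_smul_starProjection_of_bound hV
        (fun _ => norm_ofReal_div_add_le hw0) x).tsum_sub (summable_smul_starProjection_of_bound hV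
        (fun _ => norm_ofReal_div_add_le hz) x), ← tsum_const_smul'']
    congr 1
    ext i
    rw [← sub_smul, smul_smul]
    congr 1
    have h2 := ofReal_add_ne_zero (a := a i) hz
    have h3 := ofReal_add_ne_zero (a := a i) hw0
    field_simp
    ring
  exact key.differentiableAt

end Resolvent

/-! ### Inverse transforms of `φ̂ G` for a test function `φ`. -/

section InverseLaplace

variable {E : Type*} [NormedAddCommGroup E] [NormedSpace ℂ E]

theorem bromwich_congr {F G : ℂ → E} (h : ∀ s : ℂ, 0 < s.re → F s = G s) {σ : ℝ} (hσ : 0 < σ)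
    (t : ℝ) : bromwich σ F t = bromwich σ G t := by
  rw [bromwich, bromwich]
  congr 1
  ext y
  rw [h _ (by simpa using hσ)]

theorem IsBromwich.congr {α K : ℝ} {F G : ℂ → E} (hF : IsBromwich α K F)
    (h : ∀ s : ℂ, 0 < s.re → F s = G s) : IsBromwich α K G := by
  refine ⟨hF.nonneg, fun s hs => ?_, fun s hs hs' => h s hs ▸ hF.bound s hs hs'⟩
  refine (hF.differentiableAt s hs).congr_of_eventuallyEq ?_
  filter_upwards [(isOpen_lt continuous_const Complex.continuous_re).mem_nhds hs] with z hz
  exact (h z hz).symm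

variable {φ : ℝ → ℂ} {α C : ℝ} {G : ℂ → E}

/-- The factor `s` from differentiation is absorbed in `s φ̂`, the transform of `φ'`; no further
decay of `G` is required. -/
theorem IsTestFunction.hasDerivAt_bromwich (h : IsTestFunction φ) (hα : α ∈ Ioo (0 : ℝ) 1)
    (hd : ∀ s : ℂ, 0 < s.re → DifferentiableAt ℂ G s)
    (hG : ∀ s : ℂ, 0 < s.re → ‖G s‖ ≤ C * (1 + ‖s‖ ^ (-α))) (t : ℝ) :
    HasDerivAt (bromwich 1 fun s => laplace φ s • G s)
      (bromwich 1 (fun s => laplace (_root_.deriv φ) s • G s) t) t := by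
  obtain ⟨K, hK⟩ := h.exists_isBromwich hα hd hG
  obtain ⟨K', hK'⟩ := h.deriv.exists_isBromwich hα hd hG
  have heq : ∀ s : ℂ, 0 < s.re →
      laplace (_root_.deriv φ) s • G s = s • laplace φ s • G s := fun s hs => by
    rw [h.laplace_deriv hs, mul_smul]
  rw [bromwich_congr heq one_pos]
  exact hK.hasDerivAt_bromwich (hK'.congr heq) hα t

theorem IsTestFunction.bromwich_zero (h : IsTestFunction φ) (hα : α ∈ Ioo (0 : ℝ) 1)
    (hd : ∀ s : ℂ, 0 < s.re → DifferentiableAt ℂ G s)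
    (hG : ∀ s : ℂ, 0 < s.re → ‖G s‖ ≤ C * (1 + ‖s‖ ^ (-α))) :
    bromwich 1 (fun s => laplace φ s • G s) 0 = 0 := by
  obtain ⟨K, hK⟩ := h.exists_isBromwich hα hd hG
  obtain ⟨K', hK'⟩ := h.deriv.exists_isBromwich hα hd hG
  refine hK.bromwich_zero (hK'.congr fun s hs => ?_) hα
  rw [h.laplace_deriv hs, mul_smul]

theorem IsTestFunction.exists_norm_bromwich_le (h : IsTestFunction φ) (hα : α ∈ Ioo (0 : ℝ) 1)
    (hd : ∀ s : ℂ, 0 < s.re → DifferentiableAt ℂ G s)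
    (hG : ∀ s : ℂ, 0 < s.re → ‖G s‖ ≤ C * (1 + ‖s‖ ^ (-α))) :
    ∃ B, ∀ t, ‖bromwich 1 (fun s => laplace φ s • G s) t‖ ≤ B := by
  obtain ⟨K, hK⟩ := h.exists_isBromwich hα hd hG
  exact ⟨_, hK.norm_bromwich_le_const hα⟩

open FracSchrodinger in
-- The derivative contributes `s` and the Abel integral `Γ(1 - α) s^(α-1)`; their product, after
-- normalisation, is `s^α`.
theorem IsTestFunction.caputo_bromwich [CompleteSpace E] (h : IsTestFunction φ)
    (hα : α ∈ Ioo (0 : ℝ) 1) (hd : ∀ s : ℂ, 0 < s.re → DifferentiableAt ℂ G s)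
    (hG : ∀ s : ℂ, 0 < s.re → ‖G s‖ ≤ C * (1 + ‖s‖ ^ (-α))) {t : ℝ} (ht : 0 ≤ t) :
    caputo α (bromwich 1 fun s => laplace φ s • G s) t
      = bromwich 1 (fun s => s ^ (α : ℂ) • laplace φ s • G s) t := by
  obtain ⟨K', hK'⟩ := h.deriv.exists_isBromwich hα hd hG
  have hΓ : Real.Gamma (1 - α) ≠ 0 := (Real.Gamma_pos_of_pos (by linarith [hα.2])).ne'
  have h1 : ∫ τ in (0 : ℝ)..t, ((t - τ) ^ (-α)) •
      derivWithin (bromwich 1 fun s => laplace φ s • G s) (Ici 0) τ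
      = ∫ τ in (0 : ℝ)..t, ((t - τ) ^ (-α)) •
        bromwich 1 (fun s => laplace (_root_.deriv φ) s • G s) τ := by
    refine intervalIntegral.integral_congr fun τ hτ => ?_
    rw [uIcc_of_le ht] at hτ
    have := ((h.hasDerivAt_bromwich hα hd hG τ).hasDerivWithinAt (s := Ici 0)).derivWithin
      (uniqueDiffOn_Ici (0 : ℝ) τ hτ.1)
    simp only [this]
  rw [caputo, h1, hK'.integral_rpow_smul_bromwich hα ht, smul_smul, inv_mul_cancel₀ hΓ, one_smul]
  refine bromwich_congr (fun s hs => ?_) one_pos t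
  have hs0 : s ≠ 0 := by rintro rfl; simp at hs
  rw [h.laplace_deriv hs, mul_smul, smul_smul]
  congr 1
  rw [Complex.cpow_sub _ _ hs0, Complex.cpow_one, div_mul_cancel₀ _ hs0]

theorem bromwich_eq_of_clm {E' : Type*} [NormedAddCommGroup E'] [NormedSpace ℂ E']
    [CompleteSpace E] [CompleteSpace E'] {K : ℝ} {F : ℂ → E} (hF : IsBromwich α K F)
    (hα : α ∈ Ioo (0 : ℝ) 1) (T : E →L[ℂ] E') (t : ℝ) :
    T (bromwich 1 F t) = bromwich 1 (fun s => T (F s)) t := by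
  have := T.integral_comp_comm (hF.integrable hα one_pos t)
  rw [bromwich, ← this, bromwich]
  simp only [map_smul]

end InverseLaplace

/-! ### The abstract equation `i ∂_t^α u + A u = φ x`: existence, and the transform of any solution.
-/

section Evolution

variable {H : Type*} [NormedAddCommGroup H] [InnerProductSpace ℂ H] [CompleteSpace H]
  {ι : Type*} {V : ι → Submodule ℂ H} [∀ i, (V i).HasOrthogonalProjection] {a : ι → ℝ} {α : ℝ}

variable (V) in
/-- `(A + z)⁻¹ = z⁻¹ (1 - A (A + z)⁻¹)`. -/
noncomputable def resolventApply (a : ι → ℝ) (z : ℂ) (x : H) : H :=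
  z⁻¹ • (x - resolventMul V a z x)

theorem I_mul_cpow_ne_zero (hα : α ∈ Ioo (0 : ℝ) 1) {s : ℂ} (hs : 0 < s.re) :
    Complex.I * s ^ (α : ℂ) ≠ 0 := fun h => by
  have := im_I_mul_cpow_pos hα hs
  rw [h] at this
  simp at this

theorem differentiableAt_I_mul_cpow {s : ℂ} (hs : 0 < s.re) :
    DifferentiableAt ℂ (fun s : ℂ => Complex.I * s ^ (α : ℂ)) s :=
  (differentiableAt_id.cpow_const (Or.inl hs)).const_mul _

theorem differentiableAt_resolventMul_symbol
    (hV : OrthogonalFamily ℂ (fun i => V i) fun i => (V i).subtypeₗᵢ) (hα : α ∈ Ioo (0 : ℝ) 1)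
    (x : H) {s : ℂ} (hs : 0 < s.re) :
    DifferentiableAt ℂ (fun s : ℂ => resolventMul V a (Complex.I * s ^ (α : ℂ)) x) s :=
  DifferentiableAt.comp (g := fun z => resolventMul V a z x) s
    (differentiableAt_resolventMul hV (im_I_mul_cpow_pos hα hs) x) (differentiableAt_I_mul_cpow hs)

theorem differentiableAt_resolventApply_symbol
    (hV : OrthogonalFamily ℂ (fun i => V i) fun i => (V i).subtypeₗᵢ) (hα : α ∈ Ioo (0 : ℝ) 1)
    (x : H) {s : ℂ} (hs : 0 < s.re) :
    DifferentiableAt ℂ (fun s : ℂ => resolventApply V a (Complex.I * s ^ (α : ℂ)) x) s :=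
  ((differentiableAt_I_mul_cpow hs).inv (I_mul_cpow_ne_zero hα hs)).smul
    ((differentiableAt_const x).sub (differentiableAt_resolventMul_symbol hV hα x hs))

theorem norm_resolventMul_symbol_le
    (hV : OrthogonalFamily ℂ (fun i => V i) fun i => (V i).subtypeₗᵢ) (hα : α ∈ Ioo (0 : ℝ) 1)
    (x : H) {s : ℂ} (hs : 0 < s.re) :
    ‖resolventMul V a (Complex.I * s ^ (α : ℂ)) x‖
      ≤ (1 + (Real.cos (Real.pi / 2 * α))⁻¹) * ‖x‖ := by
  refine (norm_resolventMul_le hV (im_I_mul_cpow_pos hα hs) x).trans ?_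
  gcongr
  exact norm_I_mul_cpow_div_im_le hα hs

theorem norm_resolventMul_symbol_le'
    (hV : OrthogonalFamily ℂ (fun i => V i) fun i => (V i).subtypeₗᵢ) (hα : α ∈ Ioo (0 : ℝ) 1)
    (x : H) {s : ℂ} (hs : 0 < s.re) :
    ‖resolventMul V a (Complex.I * s ^ (α : ℂ)) x‖
      ≤ ((2 + (Real.cos (Real.pi / 2 * α))⁻¹) * ‖x‖) * (1 + ‖s‖ ^ (-α)) := by
  have h1 := norm_resolventMul_symbol_le (a := a) hV hα x hs
  have h2 : 0 ≤ ‖s‖ ^ (-α) := by positivity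
  have h3 := inv_pos.2 (cos_pi_div_two_mul_pos hα)
  refine h1.trans ((mul_le_mul_of_nonneg_right (by linarith) (norm_nonneg x)).trans
    (le_mul_of_one_le_right (by positivity) (by linarith)))

/-- The term `|s|^(-α)` comes from `z⁻¹`, by which `resolventApply` acts on the complement of the
family, so it cannot be dropped near `s = 0`. -/
theorem norm_resolventApply_symbol_le
    (hV : OrthogonalFamily ℂ (fun i => V i) fun i => (V i).subtypeₗᵢ) (hα : α ∈ Ioo (0 : ℝ) 1)
    (x : H) {s : ℂ} (hs : 0 < s.re) :
    ‖resolventApply V a (Complex.I * s ^ (α : ℂ)) x‖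
      ≤ ((2 + (Real.cos (Real.pi / 2 * α))⁻¹) * ‖x‖) * (1 + ‖s‖ ^ (-α)) := by
  have h1 := norm_resolventMul_symbol_le (a := a) hV hα x hs
  have h2 : 0 ≤ ‖s‖ ^ (-α) := by positivity
  have h3 := inv_pos.2 (cos_pi_div_two_mul_pos hα)
  have h4 : ‖x - resolventMul V a (Complex.I * s ^ (α : ℂ)) x‖
      ≤ (2 + (Real.cos (Real.pi / 2 * α))⁻¹) * ‖x‖ := by
    refine (norm_sub_le _ _).trans ?_
    linarith
  rw [resolventApply, norm_smul, norm_inv, norm_mul, Complex.norm_I, one_mul,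
    Complex.norm_cpow_real, ← Real.rpow_neg (norm_nonneg _), mul_comm]
  have h5 : 0 ≤ (2 + (Real.cos (Real.pi / 2 * α))⁻¹) * ‖x‖ := by positivity
  gcongr
  linarith

theorem starProjection_resolventMul_eq_smul_resolventApply
    (hV : OrthogonalFamily ℂ (fun i => V i) fun i => (V i).subtypeₗᵢ) {z : ℂ} (hz : 0 < z.im)
    (x : H) (i : ι) : (V i).starProjection (resolventMul V a z x)
      = (a i : ℂ) • (V i).starProjection (resolventApply V a z x) := by
  have h0 : z ≠ 0 := by rintro rfl; simp at hz
  have h1 := ofReal_add_ne_zero (a := a i) hz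
  rw [resolventApply, map_smul, map_sub, starProjection_resolventMul hV hz, smul_smul]
  nth_rewrite 2 [← one_smul ℂ ((V i).starProjection x)]
  rw [← sub_smul, smul_smul]
  congr 1
  field_simp
  ring

open FracSchrodinger

/-- Existence for `i ∂_t^α u + A u = φ x`, where `w = A u`. -/
theorem exists_fractional_evolution
    (hV : OrthogonalFamily ℂ (fun i => V i) fun i => (V i).subtypeₗᵢ) (hα : α ∈ Ioo (0 : ℝ) 1)
    (a : ι → ℝ) {φ : ℝ → ℂ} (hφ : IsTestFunction φ) (x : H) :
    ∃ u w u' w' : ℝ → H, (∀ t, HasDerivAt u (u' t) t) ∧ (∀ t, HasDerivAt w (w' t) t) ∧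
      Continuous u' ∧ Continuous w' ∧ (∃ C, ∀ t, ‖u t‖ ≤ C ∧ ‖w t‖ ≤ C) ∧
      (∃ C, ∀ t, ‖u' t‖ ≤ C ∧ ‖w' t‖ ≤ C) ∧ u 0 = 0 ∧
      (∀ t, 0 < t → Complex.I • caputo α u t + w t = φ t • x) ∧
      (∀ t i, (V i).starProjection (w t) = (a i : ℂ) • (V i).starProjection (u t)) ∧
      ∀ t, spectralMul V (fun _ => 1) (w t) = w t := by
  -- `Φ = φ / 2π` compensates the factor `2π` in `bromwich_laplace`.
  obtain ⟨Φ, hΦ, hΦφ⟩ : ∃ Φ, IsTestFunction Φ ∧ ∀ t, φ t = ((2 * Real.pi : ℝ) : ℂ) * Φ t := by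
    refine ⟨fun t => (((2 * Real.pi)⁻¹ : ℝ) : ℂ) * φ t, ⟨contDiff_const.mul hφ.contDiff,
      hφ.hasCompactSupport.mul_left, (closure_mono (Function.support_mul_subset_right _ _)).trans
        hφ.tsupport_subset⟩, fun t => ?_⟩
    rw [← mul_assoc, ← Complex.ofReal_mul, mul_inv_cancel₀ (by positivity), Complex.ofReal_one,
      one_mul]
  have dA := fun (s : ℂ) (hs : 0 < s.re) =>
    differentiableAt_resolventApply_symbol (a := a) hV hα x hs
  have dW := fun (s : ℂ) (hs : 0 < s.re) =>
    differentiableAt_resolventMul_symbol (a := a) hV hα x hs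
  have bA := fun (s : ℂ) (hs : 0 < s.re) => norm_resolventApply_symbol_le (a := a) hV hα x hs
  have bW := fun (s : ℂ) (hs : 0 < s.re) => norm_resolventMul_symbol_le' (a := a) hV hα x hs
  obtain ⟨CA, hCA⟩ := hΦ.exists_norm_bromwich_le hα dA bA
  obtain ⟨CW, hCW⟩ := hΦ.exists_norm_bromwich_le hα dW bW
  obtain ⟨CA', hCA'⟩ := hΦ.deriv.exists_norm_bromwich_le hα dA bA
  obtain ⟨CW', hCW'⟩ := hΦ.deriv.exists_norm_bromwich_le hα dW bW
  obtain ⟨KA, hKA⟩ := hΦ.exists_isBromwich hα dA bA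
  obtain ⟨KW, hKW⟩ := hΦ.exists_isBromwich hα dW bW
  -- `u` and `w` are the inverse transforms of `Φ̂ (A + z)⁻¹ x` and `Φ̂ A (A + z)⁻¹ x`; for `u'` and
  -- `w'` replace `Φ` by its derivative.
  refine ⟨_, _, _, _, hΦ.hasDerivAt_bromwich hα dA bA, hΦ.hasDerivAt_bromwich hα dW bW,
    continuous_iff_continuousAt.2 fun t =>
      (hΦ.deriv.hasDerivAt_bromwich hα dA bA t).continuousAt,
    continuous_iff_continuousAt.2 fun t =>
      (hΦ.deriv.hasDerivAt_bromwich hα dW bW t).continuousAt,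
    ⟨max CA CW, fun t => ⟨(hCA t).trans (le_max_left _ _), (hCW t).trans (le_max_right _ _)⟩⟩,
    ⟨max CA' CW', fun t => ⟨(hCA' t).trans (le_max_left _ _), (hCW' t).trans (le_max_right _ _)⟩⟩,
    hΦ.bromwich_zero hα dA bA, fun t ht => ?_, fun t i => ?_, fun t => ?_⟩
  · rw [hΦ.caputo_bromwich hα dA bA ht.le, hΦφ, ← hΦ.bromwich_laplace t]
    have b1 := fun (s : ℂ) (hs : 0 < s.re) => show ‖x‖ ≤ ‖x‖ * (1 + ‖s‖ ^ (-α)) from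
      le_mul_of_one_le_right (norm_nonneg x)
        (by have : 0 ≤ ‖s‖ ^ (-α) := by positivity
            linarith)
    -- The equation is the inverse transform of `z (A + z)⁻¹ x = x - A (A + z)⁻¹ x`; the constant
    -- term needs its own integrability.
    obtain ⟨K1, hK1⟩ := hΦ.exists_isBromwich hα (G := fun _ => x)
      (fun s _ => differentiableAt_const x) b1
    have e1 : Complex.I • bromwich 1 (fun s => s ^ (α : ℂ) • laplace Φ s •
        resolventApply V a (Complex.I * s ^ (α : ℂ)) x) t = bromwich 1 (fun s => laplace Φ s • x) t
        - bromwich 1 (fun s => laplace Φ s • resolventMul V a (Complex.I * s ^ (α : ℂ)) x) t := by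
      rw [bromwich, bromwich, bromwich, ← integral_smul,
        ← integral_sub (hK1.integrable hα one_pos t) (hKW.integrable hα one_pos t)]
      congr 1
      ext y
      have hz := I_mul_cpow_ne_zero hα
        (show 0 < (((1 : ℝ) : ℂ) + y * Complex.I).re by simp)
      rw [← smul_sub, ← smul_sub, resolventApply]
      simp only [smul_smul]
      congr 1
      generalize (((1 : ℝ) : ℂ) + y * Complex.I) = s at hz
      have hs := right_ne_zero_of_mul hz
      field_simp
    rw [e1, sub_add_cancel, bromwich, bromwich, ← integral_smul_const]
    simp only [smul_assoc]
  · rw [bromwich_eq_of_clm hKA hα, bromwich_eq_of_clm hKW hα, bromwich, bromwich, ← integral_smul]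
    congr 1
    ext y
    rw [map_smul, map_smul, starProjection_resolventMul_eq_smul_resolventApply hV
      (im_I_mul_cpow_pos hα (by simp)), smul_comm (a i : ℂ), smul_comm (a i : ℂ)]
  · obtain ⟨T, hT⟩ := exists_clm_spectralMul (m := fun _ => (1 : ℂ)) (C := 1) hV zero_le_one
      (fun _ => by simp)
    rw [← hT, bromwich_eq_of_clm hKW hα]
    refine bromwich_congr (fun s hs => ?_) one_pos t
    rw [map_smul, hT, spectralMul_one_resolventMul hV (im_I_mul_cpow_pos hα hs)]

theorem laplace_clm {E E' : Type*} [NormedAddCommGroup E] [NormedSpace ℂ E] [CompleteSpace E]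
    [NormedAddCommGroup E'] [NormedSpace ℂ E'] [CompleteSpace E'] (T : E →L[ℂ] E') {f : ℝ → E}
    {s : ℂ} (hf : IntegrableOn (fun t : ℝ => Complex.exp (-(s * t)) • f t) (Ioi 0)) :
    T (laplace f s) = laplace (fun t => T (f t)) s := by
  rw [laplace, ← T.integral_comp_comm hf, laplace]
  simp only [map_smul]

/-- The Laplace transform of a solution of `i ∂_t^α u + A u = φ x`, where `w = A u`. -/
theorem laplace_fractional_evolution
    (hV : OrthogonalFamily ℂ (fun i => V i) fun i => (V i).subtypeₗᵢ) (hα : α ∈ Ioo (0 : ℝ) 1)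
 {φ : ℝ → ℂ} {x : H} {u w : ℝ → H} {C C' : ℝ}
    (hu : ContDiffOn ℝ 1 u (Ici 0)) (hw : ContinuousOn w (Ici 0))
    (hC : ∀ t, 0 ≤ t → ‖u t‖ ≤ C ∧ ‖w t‖ ≤ C)
    (hC' : ∀ t, 0 ≤ t → ‖derivWithin u (Ici 0) t‖ ≤ C') (hu0 : u 0 = 0)
    (heq : ∀ t, 0 < t → Complex.I • caputo α u t + w t = φ t • x)
    (hP : ∀ t, 0 ≤ t → ∀ i, (V i).starProjection (w t) = (a i : ℂ) • (V i).starProjection (u t))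
    (h1 : ∀ t, 0 ≤ t → spectralMul V (fun _ => 1) (w t) = w t) {s : ℂ} (hs : 0 < s.re) :
    laplace u s = laplace φ s • resolventApply V a (Complex.I * s ^ (α : ℂ)) x := by
  obtain ⟨iC, hcap⟩ := laplace_caputo hα hu hu0 (fun t ht => (hC t ht).1) hC' hs
  have iu := integrableOn_exp_neg_mul_smul (hu.continuousOn.mono Ioi_subset_Ici_self)
    (fun t ht => (hC t ht.le).1) hs
  have iw := integrableOn_exp_neg_mul_smul (hw.mono Ioi_subset_Ici_self)
    (fun t ht => (hC t ht.le).2) hs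
  have hz := im_I_mul_cpow_pos hα hs
  have hz0 := I_mul_cpow_ne_zero hα hs
  have e1 : (Complex.I * s ^ (α : ℂ)) • laplace u s + laplace w s = laplace φ s • x := by
    have e2 : laplace φ s • x = ∫ t in Ioi (0 : ℝ), (Complex.I • (Complex.exp (-(s * t)) •
        caputo α u t) + Complex.exp (-(s * t)) • w t) := by
      rw [laplace, ← integral_smul_const]
      refine setIntegral_congr_fun measurableSet_Ioi fun t ht => ?_
      rw [smul_comm, ← smul_add, heq t ht, smul_assoc]
    have iC' : IntegrableOn (fun t : ℝ => Complex.I • (Complex.exp (-(s * t)) •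
        caputo α u t)) (Ioi 0) := iC.smul _
    rw [e2, integral_add iC' iw, integral_smul, mul_smul, ← hcap]
    rfl
  have hlP : ∀ i, (V i).starProjection (laplace w s)
      = (a i : ℂ) • (V i).starProjection (laplace u s) := by
    intro i
    rw [laplace_clm _ iw, laplace_clm _ iu, laplace, laplace, ← integral_smul]
    refine setIntegral_congr_fun measurableSet_Ioi fun t ht => ?_
    simp only [hP t (le_of_lt ht) i]
    rw [smul_comm]
  have hl1 : spectralMul V (fun _ => 1) (laplace w s) = laplace w s := by
    obtain ⟨T, hT⟩ := exists_clm_spectralMul (m := fun _ => (1 : ℂ)) (C := 1) hV zero_le_one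
      (fun _ => by simp)
    rw [← hT, laplace_clm _ iw]
    refine setIntegral_congr_fun measurableSet_Ioi fun t ht => ?_
    simp only [hT, h1 t (le_of_lt ht)]
  -- Projecting `z û + ŵ = φ̂ x` gives `(a_i + z) P_i û = φ̂ P_i x`, hence every `P_i ŵ`. As `ŵ` is
  -- in the closed span, this determines it; `û` then follows from the equation, including its part
  -- outside the span.
  have hw2 : laplace w s
      = laplace φ s • resolventMul V a (Complex.I * s ^ (α : ℂ)) x := by
    obtain ⟨T, hT⟩ := exists_clm_spectralMul (V := V)
      (m := fun i => (a i : ℂ) / ((a i : ℂ) + Complex.I * s ^ (α : ℂ)))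
      (C := 1 + ‖Complex.I * s ^ (α : ℂ)‖ / (Complex.I * s ^ (α : ℂ)).im) hV (by positivity)
      (fun _ => norm_ofReal_div_add_le hz)
    rw [resolventMul, ← hT, ← map_smul, hT, eq_comm]
    refine spectralMul_eq_of_starProjection_eq hl1 fun i => ?_
    rw [← e1, map_add, map_smul, hlP i, ← add_smul, smul_smul]
    congr 1
    have := ofReal_add_ne_zero (a := a i) hz
    field_simp
    ring
  have e3 : laplace u s = (Complex.I * s ^ (α : ℂ))⁻¹ • (laplace φ s • x - laplace w s) := by
    rw [← e1, add_sub_cancel_right, smul_smul, inv_mul_cancel₀ hz0, one_smul]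
  rw [e3, hw2, ← smul_sub, smul_comm, resolventApply]

end Evolution

namespace FracSchrodinger

/-! ### Null sets of the Riemannian volume do not depend on the metric. -/

section ChartVolume

variable {n : ℕ} {M : Type*} [TopologicalSpace M] [ChartedSpace (EuclideanSpace ℝ (Fin n)) M]
  [IsManifold (𝓡 n) ∞ M]

theorem contMDiffOn_coordVec (x : M) (i : Fin n) :
    ContMDiffOn 𝓘(ℝ, EuclideanSpace ℝ (Fin n)) (𝓡 n).tangent 0
      (fun y => (⟨(chartAt (EuclideanSpace ℝ (Fin n)) x).symm y, coordVec x i y⟩ :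
        TangentBundle (𝓡 n) M))
      (chartAt (EuclideanSpace ℝ (Fin n)) x).target := by
  have : IsManifold (𝓡 n) 1 M := .of_le (n := ∞) (by simp)
  have hopen := (chartAt (EuclideanSpace ℝ (Fin n)) x).open_target
  have h1 := (contMDiffOn_chart_symm (I := 𝓡 n) (n := 1) (x := x)).contMDiffOn_tangentMapWithin
    (m := 0) (by simp) hopen.uniqueMDiffOn
  have h2 : Continuous fun y : EuclideanSpace ℝ (Fin n) =>
      (⟨y, EuclideanSpace.basisFun (Fin n) ℝ i⟩ :
        TangentBundle (𝓡 n) (EuclideanSpace ℝ (Fin n))) := by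
    have := (tangentBundleModelSpaceHomeomorph (𝓡 n)).symm.continuous.comp
      (continuous_id.prodMk (continuous_const (y := EuclideanSpace.basisFun (Fin n) ℝ i)))
    rw [tangentBundleModelSpaceHomeomorph_coe_symm] at this
    exact this
  rw [contMDiffOn_zero_iff] at h1 ⊢
  have h3 := h1.comp h2.continuousOn (s := (chartAt (EuclideanSpace ℝ (Fin n)) x).target)
    (fun y hy => hy)
  refine h3.congr fun y hy => ?_
  simp only [Function.comp, tangentMapWithin, coordVec]
  rw [mfderivWithin_of_isOpen hopen hy]

theorem continuousOn_gramMatrix_apply (g : SmoothMetric n M) (x : M) (i j : Fin n) :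
    ContinuousOn (fun y => gramMatrix g x y i j)
      (chartAt (EuclideanSpace ℝ (Fin n)) x).target := by
  rw [← contMDiffOn_zero_iff (I := 𝓡 n) (I' := 𝓘(ℝ, ℝ))]
  have h := (g.contMDiff.of_le (m := 0) (by simp)).comp_contMDiffOn
    ((contMDiffOn_chart_symm (I := 𝓡 n) (n := 0) (x := x)))
  have h2 : ContMDiffOn (𝓡 n) ((𝓡 n).prod 𝓘(ℝ, ℝ)) 0
      (fun y => Bundle.TotalSpace.mk' ℝ (E := Bundle.Trivial M ℝ)
        ((chartAt (EuclideanSpace ℝ (Fin n)) x).symm y)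
        (g.inner ((chartAt (EuclideanSpace ℝ (Fin n)) x).symm y) (coordVec x i y)
          (coordVec x j y))) (chartAt (EuclideanSpace ℝ (Fin n)) x).target := by
    apply ContMDiffOn.clm_bundle_apply₂ (F₁ := EuclideanSpace ℝ (Fin n))
      (F₂ := EuclideanSpace ℝ (Fin n))
    · exact h
    · exact contMDiffOn_coordVec x i
    · exact contMDiffOn_coordVec x j
  intro y hy
  have := h2 y hy
  simp only [Bundle.contMDiffWithinAt_totalSpace] at this
  exact this.2

/-- The derivative of the inverse chart is injective, so the coordinate vectors are independent and
their Gram matrix is positive definite. -/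
theorem det_gramMatrix_pos (g : SmoothMetric n M) (x : M) {y : EuclideanSpace ℝ (Fin n)}
    (hy : y ∈ (chartAt (EuclideanSpace ℝ (Fin n)) x).target) : 0 < (gramMatrix g x y).det := by
  have : IsManifold (𝓡 n) 1 M := .of_le (n := ∞) (by simp)
  refine Matrix.PosDef.det_pos (Matrix.PosDef.of_dotProduct_mulVec_pos ?_ fun v hv => ?_)
  · ext i j
    simp [gramMatrix, g.symm]
  · have hinj := (mdifferentiable_chart (I := 𝓡 n) x).symm.mfderiv_injective hy
    let T : EuclideanSpace ℝ (Fin n) →L[ℝ]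
      TangentSpace (𝓡 n) ((chartAt (EuclideanSpace ℝ (Fin n)) x).symm y) :=
      mfderiv 𝓘(ℝ, EuclideanSpace ℝ (Fin n)) (𝓡 n)
        (chartAt (EuclideanSpace ℝ (Fin n)) x).symm y
    have hT : ∑ i, v i • coordVec x i y = T (WithLp.toLp 2 v) := by
      have e1 : WithLp.toLp 2 v = ∑ i, v i • EuclideanSpace.basisFun (Fin n) ℝ i := by
        ext j
        simp [Pi.single_apply]
      rw [e1, map_sum]
      simp only [map_smul]
      rfl
    have hne : T (WithLp.toLp 2 v) ≠ 0 := by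
      intro h0
      refine hv ?_
      have h1 : WithLp.toLp 2 v = 0 := hinj (h0.trans (map_zero T).symm)
      ext i
      exact congrArg (fun w : EuclideanSpace ℝ (Fin n) => w i) h1
    have hpos := g.pos _ _ hne
    rw [← hT] at hpos
    have e2 : ∀ w : TangentSpace (𝓡 n) ((chartAt (EuclideanSpace ℝ (Fin n)) x).symm y),
        g.inner _ w (∑ j, v j • coordVec x j y) = ∑ j, v j * g.inner _ w (coordVec x j y) := by
      intro w
      rw [map_sum]
      exact Finset.sum_congr rfl fun j _ => (g.inner _ w).map_smul (v j) _
    have e3 : g.inner _ (∑ i, v i • coordVec x i y) (∑ j, v j • coordVec x j y)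
        = ∑ i, v i * ∑ j, v j * g.inner _ (coordVec x i y) (coordVec x j y) := by
      rw [g.symm, e2]
      exact Finset.sum_congr rfl fun i _ => by rw [g.symm, e2]
    rw [e3] at hpos
    refine hpos.trans_eq (Finset.sum_congr rfl fun i _ => ?_)
    rw [Pi.star_apply, star_trivial]
    congr 1
    exact Finset.sum_congr rfl fun j _ => mul_comm _ _

theorem aemeasurable_density (g : SmoothMetric n M) (x : M) :
    AEMeasurable (fun y => ENNReal.ofReal (Real.sqrt (gramMatrix g x y).det))
      ((volume : Measure (EuclideanSpace ℝ (Fin n))).restrict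
        (chartAt (EuclideanSpace ℝ (Fin n)) x).target) := by
  have h : ContinuousOn (fun y => (gramMatrix g x y).det)
      (chartAt (EuclideanSpace ℝ (Fin n)) x).target := by
    simp only [Matrix.det_apply]
    exact continuousOn_finsetSum _ fun σ _ => ContinuousOn.const_smul (continuousOn_finsetProd _
      fun i _ => continuousOn_gramMatrix_apply g x _ _) _
  exact (ENNReal.continuous_ofReal.comp_continuousOn (Real.continuous_sqrt.comp_continuousOn
    h)).aemeasurable (chartAt (EuclideanSpace ℝ (Fin n)) x).open_target.measurableSet

variable [MeasurableSpace M] [BorelSpace M]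

theorem chartVolume_apply_eq_zero_iff (g : SmoothMetric n M) (x : M) {A : Set M}
    (hA : MeasurableSet A) : chartVolume g x A = 0 ↔
      volume ((chartAt (EuclideanSpace ℝ (Fin n)) x).target ∩
        (chartAt (EuclideanSpace ℝ (Fin n)) x).symm ⁻¹' A) = 0 := by
  have hopen := (chartAt (EuclideanSpace ℝ (Fin n)) x).open_target
  have hm : AEMeasurable (chartAt (EuclideanSpace ℝ (Fin n)) x).symm
      ((volume : Measure (EuclideanSpace ℝ (Fin n))).restrict
        (chartAt (EuclideanSpace ℝ (Fin n)) x).target) :=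
    (chartAt (EuclideanSpace ℝ (Fin n)) x).continuousOn_symm.aemeasurable hopen.measurableSet
  rw [chartVolume, Measure.map_apply_of_aemeasurable
    (hm.mono_ac (withDensity_absolutelyContinuous _ _)) hA,
    withDensity_apply_eq_zero' (aemeasurable_density g x),
    Measure.restrict_apply₀' hopen.measurableSet.nullMeasurableSet]
  congr! 2
  ext y
  simp only [mem_inter_iff, mem_ofPred_eq, mem_preimage, ne_eq, ENNReal.ofReal_eq_zero, not_le,
    Real.sqrt_pos]
  constructor
  · rintro ⟨⟨_, h1⟩, h2⟩
    exact ⟨h2, h1⟩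
  · rintro ⟨h1, h2⟩
    exact ⟨⟨det_gramMatrix_pos g x h1, h2⟩, h1⟩

/-- The right-hand side does not involve the metric; this is what makes any two volumes equivalent.
-/
theorem vol_apply_eq_zero_iff (g : SmoothMetric n M) {A : Set M} (hA : MeasurableSet A) :
    vol g A = 0 ↔ ∀ x : M, volume ((chartAt (EuclideanSpace ℝ (Fin n)) x).target ∩
        (chartAt (EuclideanSpace ℝ (Fin n)) x).symm ⁻¹' A) = 0 := by
  constructor
  · intro h x
    rw [← chartVolume_apply_eq_zero_iff g x hA]
    exact le_antisymm ((le_iSup (chartVolume g) x A).trans h.le) zero_le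
  · intro h
    -- The supremum may be over uncountably many charts, so null sets are not simply added: each
    -- chart volume is carried by `Aᶜ`, hence `(vol g).restrict Aᶜ` is already an upper bound.
    have hle : vol g ≤ (vol g).restrict Aᶜ := by
      refine iSup_le fun x => ?_
      have h0 := (chartVolume_apply_eq_zero_iff g x hA).2 (h x)
      have h1 : (chartVolume g x).restrict Aᶜ = chartVolume g x :=
        Measure.restrict_eq_self_of_ae_mem (by
          rw [← compl_mem_ae_iff] at h0
          exact h0)
      rw [← h1]
      exact Measure.restrict_mono le_rfl (le_iSup (chartVolume g) x)
    refine le_antisymm ((hle A).trans ?_) zero_le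
    rw [Measure.restrict_apply hA, inter_compl_self, measure_empty]

theorem vol_absolutelyContinuous (g g' : SmoothMetric n M) : vol g ≪ vol g' :=
  Measure.AbsolutelyContinuous.mk fun _ hA h =>
    (vol_apply_eq_zero_iff g hA).2 ((vol_apply_eq_zero_iff g' hA).1 h)

end ChartVolume
end FracSchrodinger

/-- In the normed quotient by the closed subspace the integrand is zero. -/
theorem Submodule.laplace_mem {E : Type*} [NormedAddCommGroup E] [NormedSpace ℂ E]
    [CompleteSpace E] (S : Submodule ℂ E) (hS : IsClosed (S : Set E)) {f : ℝ → E} {s : ℂ}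
    (hf : IntegrableOn (fun t : ℝ => Complex.exp (-(s * t)) • f t) (Ioi 0))
    (h : ∀ t, 0 < t → f t ∈ S) : laplace f s ∈ S := by
  have : IsClosed (S : Set E) := hS
  rw [← Submodule.Quotient.mk_eq_zero]
  have key := laplace_clm S.mkQL hf
  change S.mkQL (laplace f s) = 0
  rw [key, laplace, setIntegral_eq_zero_of_forall_eq_zero]
  intro t ht
  have h0 : S.mkQL (f t) = 0 := (Submodule.Quotient.mk_eq_zero S).2 (h t ht)
  rw [h0, smul_zero]

namespace FracSchrodinger

/-! ### Identifying functions across two equivalent measures. -/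

section SameFun

variable {M : Type*} [MeasurableSpace M] {μ ν : Measure M}

/-- The pairs of classes of the same function, for two equivalent measures. -/
def sameFunSubmodule (h : ν ≪ μ) (h' : μ ≪ ν) : Submodule ℂ (Lp ℂ 2 μ × Lp ℂ 2 ν) where
  carrier := {p | SameFun p.1 p.2}
  zero_mem' :=
    have h0 : ((0 : Lp ℂ 2 μ) : M → ℂ) =ᵐ[μ] (0 : Lp ℂ 2 ν) :=
      (Lp.coeFn_zero ℂ 2 μ).trans (h'.ae_eq (Lp.coeFn_zero ℂ 2 ν)).symm
    ⟨h0, h.ae_le h0⟩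
  add_mem' := fun {p q} hp hq =>
    have h0 : ((p.1 + q.1 : Lp ℂ 2 μ) : M → ℂ) =ᵐ[μ] (p.2 + q.2 : Lp ℂ 2 ν) :=
      ((Lp.coeFn_add p.1 q.1).trans (hp.1.add hq.1)).trans
        (h'.ae_eq (Lp.coeFn_add p.2 q.2)).symm
    ⟨h0, h.ae_le h0⟩
  smul_mem' := fun c {p} hp =>
    have h0 : ((c • p.1 : Lp ℂ 2 μ) : M → ℂ) =ᵐ[μ] (c • p.2 : Lp ℂ 2 ν) :=
      ((Lp.coeFn_smul c p.1).trans (hp.1.const_smul c)).trans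
        (h'.ae_eq (Lp.coeFn_smul c p.2)).symm
    ⟨h0, h.ae_le h0⟩

/-- `L²` limits are almost everywhere limits along a subsequence. A second extraction serves both
components, and the two limits agree almost everywhere. -/
theorem isClosed_sameFunSubmodule (h : ν ≪ μ) (h' : μ ≪ ν) :
    IsClosed (sameFunSubmodule h h' : Set (Lp ℂ 2 μ × Lp ℂ 2 ν)) := by
  refine IsSeqClosed.isClosed fun p q hp hpq => ?_
  have h1 : Tendsto (fun k => (p k).1) atTop (𝓝 q.1) := (continuous_fst.tendsto q).comp hpq
  have h2 : Tendsto (fun k => (p k).2) atTop (𝓝 q.2) := (continuous_snd.tendsto q).comp hpq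
  obtain ⟨m, hm, hm'⟩ := (tendstoInMeasure_of_tendsto_Lp h1).exists_seq_tendsto_ae
  obtain ⟨l, hl, hl'⟩ := (tendstoInMeasure_of_tendsto_Lp
    (h2.comp hm.tendsto_atTop)).exists_seq_tendsto_ae
  have hall : ∀ᵐ x ∂μ, ∀ k, ((p k).1 : M → ℂ) x = (p k).2 x :=
    ae_all_iff.2 fun k => (hp k).1
  have h0 : (q.1 : M → ℂ) =ᵐ[μ] q.2 := by
    filter_upwards [hm', h'.ae_le hl', hall] with x hx1 hx2 hx3
    refine tendsto_nhds_unique (hx1.comp hl.tendsto_atTop) (hx2.congr fun k => ?_)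
    exact (hx3 _).symm
  exact ⟨h0, h.ae_le h0⟩

theorem sameFun_laplace (h : ν ≪ μ) (h' : μ ≪ ν) {f : ℝ → Lp ℂ 2 μ} {f' : ℝ → Lp ℂ 2 ν} {s : ℂ}
    (hf : IntegrableOn (fun t : ℝ => Complex.exp (-(s * t)) • f t) (Ioi 0))
    (hf' : IntegrableOn (fun t : ℝ => Complex.exp (-(s * t)) • f' t) (Ioi 0))
    (hs : ∀ t, 0 < t → SameFun (f t) (f' t)) : SameFun (laplace f s) (laplace f' s) := by
  have hi : IntegrableOn (fun t : ℝ => Complex.exp (-(s * t)) • (f t, f' t)) (Ioi 0) :=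
    hf.prodMk hf'
  have h1 := (sameFunSubmodule h h').laplace_mem (isClosed_sameFunSubmodule h h') hi hs
  have h2 := laplace_clm (ContinuousLinearMap.fst ℂ (Lp ℂ 2 μ) (Lp ℂ 2 ν)) hi
  have h3 := laplace_clm (ContinuousLinearMap.snd ℂ (Lp ℂ 2 μ) (Lp ℂ 2 ν)) hi
  change SameFun (laplace (fun t => (f t, f' t)) s).1 (laplace (fun t => (f t, f' t)) s).2 at h1
  exact h2 ▸ h3 ▸ h1

end SameFun

/-! ### Orthogonality of eigenspaces and solutions of the equation on the manifold. -/

section Eigenspace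

variable {n : ℕ} {M : Type*} [TopologicalSpace M] [ChartedSpace (EuclideanSpace ℝ (Fin n)) M]
  [IsManifold (𝓡 n) ∞ M] [MeasurableSpace M]

/-- Symmetry of the Dirichlet form: `∫ g(∇u, ∇v)` equals both `l ∫ u v` and `m ∫ u v`. -/
theorem IsNegLaplacian.integral_mul_eq_zero {g : SmoothMetric n M} {l m : ℝ} (hlm : l ≠ m)
    {u v : M → ℝ} (hu : ContMDiff (𝓡 n) 𝓘(ℝ, ℝ) ∞ u) (hv : ContMDiff (𝓡 n) 𝓘(ℝ, ℝ) ∞ v)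
    (hul : IsNegLaplacian g u fun p => l * u p) (hvm : IsNegLaplacian g v fun p => m * v p) :
    ∫ p, u p * v p ∂(vol g) = 0 := by
  have h1 := hul v hv
  have h2 := hvm u hu
  simp_rw [fun p => g.symm p (grad g v p) (grad g u p)] at h2
  rw [h1] at h2
  simp_rw [mul_assoc, integral_const_mul] at h2
  simp_rw [mul_comm (v _) (u _)] at h2
  by_contra hne
  exact hlm (mul_right_cancel₀ hne h2)

theorem inner_eq_zero_of_isEigenfunction {g : SmoothMetric n M} {l m : ℝ} (hlm : l ≠ m)
    {u v : M → ℂ} (hu : IsEigenfunction g l u) (hv : IsEigenfunction g m v) {x y : L2 g}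
    (hx : (x : M → ℂ) =ᵐ[vol g] u) (hy : (y : M → ℂ) =ᵐ[vol g] v) : inner ℂ x y = (0 : ℂ) := by
  have mu : MemLp u 2 (vol g) := (memLp_congr_ae hx).1 (Lp.memLp x)
  have mv : MemLp v 2 (vol g) := (memLp_congr_ae hy).1 (Lp.memLp y)
  have hre : ContMDiff 𝓘(ℝ, ℂ) 𝓘(ℝ, ℝ) ∞ Complex.re := Complex.reCLM.contMDiff
  have him : ContMDiff 𝓘(ℝ, ℂ) 𝓘(ℝ, ℝ) ∞ Complex.im := Complex.imCLM.contMDiff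
  have e1 := IsNegLaplacian.integral_mul_eq_zero hlm (hre.comp hu.1) (hre.comp hv.1) hu.2.1 hv.2.1
  have e2 := IsNegLaplacian.integral_mul_eq_zero hlm (him.comp hu.1) (him.comp hv.1) hu.2.2 hv.2.2
  have e3 := IsNegLaplacian.integral_mul_eq_zero hlm (hre.comp hu.1) (him.comp hv.1) hu.2.1 hv.2.2
  have e4 := IsNegLaplacian.integral_mul_eq_zero hlm (him.comp hu.1) (hre.comp hv.1) hu.2.2 hv.2.1
  simp only [Function.comp] at e1 e2 e3 e4
  have i1 : Integrable (fun p => (u p).re * (v p).re) (vol g) := mu.re.integrable_mul mv.re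
  have i2 : Integrable (fun p => (u p).im * (v p).im) (vol g) := mu.im.integrable_mul mv.im
  have i3 : Integrable (fun p => (u p).re * (v p).im) (vol g) := mu.re.integrable_mul mv.im
  have i4 : Integrable (fun p => (u p).im * (v p).re) (vol g) := mu.im.integrable_mul mv.re
  have i5 : Integrable (fun p => (inner ℂ (x p) (y p) : ℂ)) (vol g) := L2.integrable_inner x y
  have hxy : ∀ᵐ p ∂(vol g), (inner ℂ (x p) (y p) : ℂ)
      = v p * (starRingEnd ℂ) (u p) := by
    filter_upwards [hx, hy] with p h1 h2
    rw [h1, h2, RCLike.inner_apply]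
  rw [L2.inner_def]
  apply Complex.ext
  · rw [← RCLike.re_eq_complex_re, ← integral_re i5, map_zero]
    have : ∫ p, ((u p).re * (v p).re + (u p).im * (v p).im) ∂(vol g) = 0 := by
      rw [integral_add i1 i2, e1, e2, add_zero]
    rw [← this]
    refine integral_congr_ae ?_
    filter_upwards [hxy] with p hp
    rw [hp, RCLike.re_eq_complex_re]
    simp only [Complex.mul_re, Complex.conj_re, Complex.conj_im]
    ring
  · rw [← RCLike.im_eq_complex_im, ← integral_im i5, map_zero]
    have : ∫ p, ((u p).re * (v p).im - (u p).im * (v p).re) ∂(vol g) = 0 := by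
      rw [integral_sub i3 i4, e3, e4, sub_zero]
    rw [← this]
    refine integral_congr_ae ?_
    filter_upwards [hxy] with p hp
    rw [hp, RCLike.im_eq_complex_im]
    simp only [Complex.mul_im, Complex.conj_re, Complex.conj_im]
    ring

theorem isOrtho_eigenspace (g : SmoothMetric n M) {l m : ℝ} (hlm : l ≠ m) :
    eigenspace g l ⟂ eigenspace g m := by
  have h : Submodule.span ℂ {x : L2 g | ∃ u : M → ℂ, IsEigenfunction g l u ∧
        (x : M → ℂ) =ᵐ[vol g] u} ⟂
      Submodule.span ℂ {x : L2 g | ∃ u : M → ℂ, IsEigenfunction g m u ∧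
        (x : M → ℂ) =ᵐ[vol g] u} := by
    rw [Submodule.isOrtho_span]
    rintro x ⟨u, hu, hx⟩ y ⟨v, hv, hy⟩
    exact inner_eq_zero_of_isEigenfunction hlm hu hv hx hy
  rw [eigenspace, eigenspace, Submodule.isOrtho_iff_le, Submodule.orthogonal_closure]
  exact Submodule.topologicalClosure_minimal _ h (Submodule.isClosed_orthogonal _)

theorem orthogonalFamily_eigenspace (g : SmoothMetric n M) :
    OrthogonalFamily ℂ (fun lam : posEigenvalues g => eigenspace g lam)
      fun lam => (eigenspace g lam).subtypeₗᵢ :=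
  OrthogonalFamily.of_pairwise fun _ _ h =>
    isOrtho_eigenspace g fun h' => h (Subtype.ext h')

variable (g : SmoothMetric n M) {α β : ℝ}

theorem exists_isSolution (hα : α ∈ Ioo (0 : ℝ) 1) (β : ℝ) {φ : ℝ → ℂ} (hφ : IsTestFunction φ)
    (x : L2 g) : ∃ u, IsSolution g α β (fun t => φ t • x) u := by
  obtain ⟨u, w, u', w', hu, hw, cu, cw, ⟨C, hC⟩, ⟨C', hC'⟩, hu0, heq, hP, h1⟩ :=
    exists_fractional_evolution (orthogonalFamily_eigenspace g) hα
      (fun lam => (lam : ℝ) ^ β) hφ x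
  have hfrac : ∀ t, fracLaplacian g β (u t) = w t := fun t =>
    spectralMul_eq_of_starProjection_eq (h1 t) (hP t)
  have hlift : sobolevLift g β u = fun t => (u t, w t) := funext fun t => by
    rw [sobolevLift, hfrac]
  have hd : ∀ t, HasDerivAt (fun t => (u t, w t)) (u' t, w' t) t := fun t =>
    HasDerivAt.prodMk (hu t) (hw t)
  have hderiv : deriv (fun t => (u t, w t)) = fun t => (u' t, w' t) := funext fun t => (hd t).deriv
  refine ⟨u, ⟨fun t _ => ?_, ?_, ⟨C, fun t _ => ?_⟩, ⟨C', fun t ht => ?_⟩, hu0, fun t ht => ?_⟩⟩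
  · refine (summable_norm_sq_starProjection (orthogonalFamily_eigenspace g) (w t)).congr
      fun lam => ?_
    rw [hP t lam, norm_smul, mul_pow, Complex.norm_real, Real.norm_of_nonneg
      (Real.rpow_nonneg lam.2.1.le _), mul_comm 2 β, Real.rpow_mul lam.2.1.le, Real.rpow_two]
    rfl
  · rw [hlift]
    refine (contDiff_one_iff_deriv.2 ⟨fun t => (hd t).differentiableAt, ?_⟩).contDiffOn
    rw [hderiv]
    exact cu.prodMk cw
  · rw [hlift]
    exact max_le (hC t).1 (hC t).2
  · rw [hlift, (hd t).hasDerivWithinAt.derivWithin (uniqueDiffOn_Ici (0 : ℝ) t ht)]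
    exact max_le (hC' t).1 (hC' t).2
  · rw [hfrac]
    exact heq t ht

theorem IsSolution.integrableOn_exp {f u : ℝ → L2 g} (h : IsSolution g α β f u) {s : ℂ}
    (hs : 0 < s.re) : IntegrableOn (fun t : ℝ => Complex.exp (-(s * t)) • u t) (Ioi 0) := by
  obtain ⟨C, hC⟩ := h.bounded
  refine integrableOn_exp_neg_mul_smul (C := C) ?_ (fun t ht => ?_) hs
  · exact (continuous_fst.comp_continuousOn h.contDiffOn.continuousOn).mono Ioi_subset_Ici_self
  · exact (norm_fst_le (sobolevLift g β u t)).trans (hC t ht.le)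

theorem IsSolution.laplace_eq (hα : α ∈ Ioo (0 : ℝ) 1) {φ : ℝ → ℂ} {x : L2 g} {u : ℝ → L2 g}
    (h : IsSolution g α β (fun t => φ t • x) u) {s : ℂ} (hs : 0 < s.re) :
    laplace u s = laplace φ s • resolventApply (fun lam : posEigenvalues g => eigenspace g lam)
      (fun lam => (lam : ℝ) ^ β) (Complex.I * s ^ (α : ℂ)) x := by
  obtain ⟨C, hC⟩ := h.bounded
  obtain ⟨C', hC'⟩ := h.deriv_bounded
  have hu : ContDiffOn ℝ 1 u (Ici 0) := h.contDiffOn.fst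
  have hw : ContinuousOn (fun t => fracLaplacian g β (u t)) (Ici 0) :=
    continuous_snd.comp_continuousOn h.contDiffOn.continuousOn
  have hdu : ∀ t, 0 ≤ t → ‖derivWithin u (Ici 0) t‖ ≤ C' := fun t ht => by
    have h1 := ((h.contDiffOn.differentiableOn one_ne_zero t ht).hasDerivWithinAt)
    have h2 : HasDerivWithinAt u (derivWithin (sobolevLift g β u) (Ici 0) t).1 (Ici 0) t :=
      (hasFDerivAt_fst (𝕜 := ℝ) (p := sobolevLift g β u t)).comp_hasDerivWithinAt t h1
    rw [h2.derivWithin (uniqueDiffOn_Ici (0 : ℝ) t ht)]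
    exact (norm_fst_le _).trans (hC' t ht)
  -- Membership in `H^{2β}` makes the series defining `fracLaplacian` converge; otherwise the sum
  -- could be the default value `0`.
  have hsum : ∀ t, 0 ≤ t → Summable fun lam : posEigenvalues g =>
      ‖(((lam : ℝ) ^ β : ℝ) : ℂ)‖ ^ 2 * ‖(eigenspace g lam).starProjection (u t)‖ ^ 2 := by
    intro t ht
    refine (h.memSobolev t ht).congr fun lam => ?_
    rw [Complex.norm_real, Real.norm_of_nonneg
      (Real.rpow_nonneg lam.2.1.le _), mul_comm 2 β, Real.rpow_mul lam.2.1.le, Real.rpow_two]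
    rfl
  exact laplace_fractional_evolution (orthogonalFamily_eigenspace g) hα (C := C) (C' := C')
    (w := fun t => fracLaplacian g β (u t)) hu hw
    (fun t ht => ⟨(norm_fst_le (sobolevLift g β u t)).trans (hC t ht),
      (norm_snd_le (sobolevLift g β u t)).trans (hC t ht)⟩) hdu h.init h.equation
    (fun t ht lam => starProjection_spectralMul (orthogonalFamily_eigenspace g) (hsum t ht) lam)
    (fun t ht => spectralMul_one_spectralMul (orthogonalFamily_eigenspace g) (hsum t ht)) hs

theorem isSolution_solution {f : ℝ → L2 g} (h : ∃ u, IsSolution g α β f u) :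
    IsSolution g α β f (solution g α β f) := by
  rw [solution, dif_pos h]
  exact h.choose_spec

end Eigenspace

/-! ### From the source-to-solution map to the local resolvents. -/

section SourceToSolution

theorem isC2c_smul {X : Type*} [MeasurableSpace X] {μ : Measure X} {φ : ℝ → ℂ} (hφ : IsTestFunction φ) (ξ : Lp ℂ 2 μ) :
    IsC2c fun t => φ t • ξ := by
  refine ⟨(contDiff_infty.1 hφ.contDiff 2).smul contDiff_const, hφ.hasCompactSupport.smul_right,
    (closure_mono fun t ht => ?_).trans hφ.tsupport_subset⟩
  intro h0
  exact ht (show φ t • ξ = 0 by rw [h0, zero_smul])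

variable {n : ℕ} {M : Type*} [TopologicalSpace M] [ChartedSpace (EuclideanSpace ℝ (Fin n)) M]
  [IsManifold (𝓡 n) ∞ M] [MeasurableSpace M] [BorelSpace M] {α β β' : ℝ}

/-- The operator `A (A + z)⁻¹` between two open sets, where `A = (-Δ_g)^β`. -/
noncomputable def localResolventMul (g : SmoothMetric n M) (β : ℝ) (W₁ W₂ : TopologicalSpace.Opens M) (z : ℂ)
    (ξ : L2On g (W₁ : Set M)) : L2On g (W₂ : Set M) :=
  restr g W₂ (resolventMul (fun lam : posEigenvalues g => eigenspace g lam)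
    (fun lam => (lam : ℝ) ^ β) z (zeroExt g W₁ ξ))

/-- The restriction to `W₂` of the orthogonal projection of `L²(W₁)` onto the closed span of the
eigenspaces for the positive eigenvalues. -/
noncomputable def localPosProj (g : SmoothMetric n M) (W₁ W₂ : TopologicalSpace.Opens M)
    (ξ : L2On g (W₁ : Set M)) : L2On g (W₂ : Set M) :=
  restr g W₂ (spectralMul (fun lam : posEigenvalues g => eigenspace g lam) (fun _ => 1)
    (zeroExt g W₁ ξ))

theorem laplace_sourceToSolution (g : SmoothMetric n M) (hα : α ∈ Ioo (0 : ℝ) 1) (β : ℝ)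
    (W₁ W₂ : TopologicalSpace.Opens M) {φ : ℝ → ℂ} (hφ : IsTestFunction φ)
    (ξ : L2On g (W₁ : Set M)) {s : ℂ} (hs : 0 < s.re) :
    IntegrableOn (fun t : ℝ => Complex.exp (-(s * t)) •
      restr g W₂ (solution g α β (fun τ => zeroExt g W₁ (φ τ • ξ)) t)) (Ioi 0) ∧
    laplace (fun t => restr g W₂ (solution g α β (fun τ => zeroExt g W₁ (φ τ • ξ)) t)) s
      = laplace φ s • (Complex.I * s ^ (α : ℂ))⁻¹ • (restr g W₂ (zeroExt g W₁ ξ) -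
        localResolventMul g β W₁ W₂ (Complex.I * s ^ (α : ℂ)) ξ) := by
  have hsol := isSolution_solution g (exists_isSolution g hα β hφ (zeroExt g W₁ ξ))
  simp only [map_smul]
  have hi := hsol.integrableOn_exp g hs
  constructor
  · have := (restr g W₂).integrable_comp hi
    simp only [map_smul] at this
    exact this
  · rw [← laplace_clm (restr g W₂) hi, hsol.laplace_eq g hα hs, map_smul, resolventApply, map_smul,
      map_sub]
    rfl

/-- Both sides are the indicator of `W₁` times the given function, seen on `W₂`; the metric enters
only through null sets. -/
theorem sameFun_restr_zeroExt (g g' : SmoothMetric n M) (W₁ W₂ : TopologicalSpace.Opens M)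
    {ξ : L2On g (W₁ : Set M)} {ξ' : L2On g' (W₁ : Set M)} (h : SameFun ξ ξ') :
    SameFun (restr g W₂ (zeroExt g W₁ ξ)) (restr g' W₂ (zeroExt g' W₁ ξ')) := by
  have key : ∀ (g : SmoothMetric n M) (ξ : L2On g (W₁ : Set M)),
      (restr g W₂ (zeroExt g W₁ ξ) : M → ℂ) =ᵐ[(vol g).restrict W₂]
        (W₁ : Set M).indicator ξ := fun g ξ => by
    have hm : MemLp ((W₁ : Set M).indicator (ξ : M → ℂ)) 2 (vol g) :=
      (memLp_indicator_iff_restrict W₁.isOpen.measurableSet).2 (Lp.memLp ξ)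
    have hz : zeroExt g W₁ ξ = hm.toLp := rfl
    rw [hz]
    exact (LpToLpRestrictCLM_coeFn ℂ (W₂ : Set M) hm.toLp).trans (ae_restrict_of_ae hm.coeFn_toLp)
  have h1 : (W₁ : Set M).indicator (ξ : M → ℂ) =ᵐ[(vol g).restrict (W₂ : Set M)]
      (W₁ : Set M).indicator (ξ' : M → ℂ) :=
    ae_restrict_of_ae
      ((ae_eq_restrict_iff_indicator_ae_eq (μ := vol g) W₁.isOpen.measurableSet).1 h.1)
  have hac : (vol g').restrict (W₂ : Set M) ≪ (vol g).restrict (W₂ : Set M) :=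
    (vol_absolutelyContinuous g' g).restrict _
  have hac' : (vol g).restrict (W₂ : Set M) ≪ (vol g').restrict (W₂ : Set M) :=
    (vol_absolutelyContinuous g g').restrict _
  have h2 := ((key g ξ).trans h1).trans (hac'.ae_eq (key g' ξ')).symm
  exact ⟨h2, hac.ae_eq h2⟩

variable {g g' : SmoothMetric n M} {W₁ W₂ : TopologicalSpace.Opens M}

/-- Test with sources `φ(t) ξ` where `φ̂(s) ≠ 0`: divide the transform by the nonzero scalar `φ̂(s)
z⁻¹`, then subtract the metric-free identity term. -/
theorem sameFun_localResolventMul (hα : α ∈ Ioo (0 : ℝ) 1)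
    (hL : ∀ (f : ℝ → L2On g (W₁ : Set M)) (f' : ℝ → L2On g' (W₁ : Set M)),
      IsC2c f → IsC2c f' → (∀ t, SameFun (f t) (f' t)) →
      ∀ t, SameFun (sourceToSolution g α β W₁ W₂ f t) (sourceToSolution g' α β' W₁ W₂ f' t))
    {s : ℂ} (hs : 0 < s.re) {ξ : L2On g (W₁ : Set M)} {ξ' : L2On g' (W₁ : Set M)}
    (h : SameFun ξ ξ') :
    SameFun (localResolventMul g β W₁ W₂ (Complex.I * s ^ (α : ℂ)) ξ)
      (localResolventMul g' β' W₁ W₂ (Complex.I * s ^ (α : ℂ)) ξ') := by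
  obtain ⟨φ, hφ, hφs⟩ := exists_isTestFunction_laplace_ne_zero s
  have hac : ∀ W : TopologicalSpace.Opens M, (vol g').restrict (W : Set M) ≪
    (vol g).restrict (W : Set M) := fun W => (vol_absolutelyContinuous g' g).restrict _
  have hac' : ∀ W : TopologicalSpace.Opens M, (vol g).restrict (W : Set M) ≪
    (vol g').restrict (W : Set M) := fun W => (vol_absolutelyContinuous g g').restrict _
  let S₁ := sameFunSubmodule (hac W₁) (hac' W₁)
  let S := sameFunSubmodule (hac W₂) (hac' W₂)
  have hf : ∀ t, SameFun (φ t • ξ) (φ t • ξ') := fun t =>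
    S₁.smul_mem (φ t) (show (ξ, ξ') ∈ S₁ from h)
  have hsol := hL _ _ (isC2c_smul hφ ξ) (isC2c_smul hφ ξ') hf
  obtain ⟨i1, e1⟩ := laplace_sourceToSolution g hα β W₁ W₂ hφ ξ hs
  obtain ⟨i2, e2⟩ := laplace_sourceToSolution g' hα β' W₁ W₂ hφ ξ' hs
  have h1 := sameFun_laplace (hac W₂) (hac' W₂) i1 i2 fun t ht => hsol ⟨t, ht⟩
  rw [e1, e2, smul_smul, smul_smul] at h1
  have hz : laplace φ s * (Complex.I * s ^ (α : ℂ))⁻¹ ≠ 0 :=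
    mul_ne_zero hφs (inv_ne_zero (I_mul_cpow_ne_zero hα hs))
  have h2 : (restr g W₂ (zeroExt g W₁ ξ) -
        localResolventMul g β W₁ W₂ (Complex.I * s ^ (α : ℂ)) ξ,
      restr g' W₂ (zeroExt g' W₁ ξ') -
        localResolventMul g' β' W₁ W₂ (Complex.I * s ^ (α : ℂ)) ξ') ∈ S :=
    (S.smul_mem_iff hz).1 h1
  have h3 : (restr g W₂ (zeroExt g W₁ ξ), restr g' W₂ (zeroExt g' W₁ ξ')) ∈ S :=
    sameFun_restr_zeroExt g g' W₁ W₂ h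
  have h4 := S.sub_mem h3 h2
  rw [Prod.mk_sub_mk, sub_sub_cancel, sub_sub_cancel] at h4
  exact h4

/-- Each positive `a` satisfies `a / (a + z) → 1` as `z → 0`, and the sector bound is uniform in
`z`. This isolates the positive part of the spectrum from the zero mode. -/
theorem tendsto_localResolventMul (g : SmoothMetric n M) (W₁ W₂ : TopologicalSpace.Opens M)
    (hα : α ∈ Ioo (0 : ℝ) 1) (β : ℝ) (ξ : L2On g (W₁ : Set M)) :
    Tendsto (fun ε : ℝ => localResolventMul g β W₁ W₂ (Complex.I * (ε : ℂ) ^ (α : ℂ)) ξ)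
      (𝓝[>] 0) (𝓝 (localPosProj g W₁ W₂ ξ)) := by
  refine ((restr g W₂).continuous.tendsto _).comp ?_
  refine tendsto_spectralMul (orthogonalFamily_eigenspace g)
    (C := 1 + (Real.cos (Real.pi / 2 * α))⁻¹) ?_ (fun lam => ?_) (fun lam => ?_) _
  · filter_upwards [self_mem_nhdsWithin] with ε hε lam
    have hε' : 0 < (ε : ℂ).re := by simpa using hε
    refine (norm_ofReal_div_add_le (im_I_mul_cpow_pos hα hε')).trans ?_
    gcongr
    exact norm_I_mul_cpow_div_im_le hα hε'
  · have := inv_pos.2 (cos_pi_div_two_mul_pos hα)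
    rw [norm_one]
    linarith
  · have ha : (((lam : ℝ) ^ β : ℝ) : ℂ) ≠ 0 := by
      exact_mod_cast (Real.rpow_pos_of_pos lam.2.1 β).ne'
    have h0 : Tendsto (fun ε : ℝ => Complex.I * (ε : ℂ) ^ (α : ℂ)) (𝓝[>] 0) (𝓝 0) := by
      rw [tendsto_zero_iff_norm_tendsto_zero]
      have h1 : Tendsto (fun ε : ℝ => ε ^ α) (𝓝[>] 0) (𝓝 0) := by
        have := (Real.continuousAt_rpow_const 0 α (Or.inr hα.1.le)).tendsto
        rw [Real.zero_rpow hα.1.ne'] at this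
        exact this.mono_left nhdsWithin_le_nhds
      refine h1.congr' ?_
      filter_upwards [self_mem_nhdsWithin] with ε hε
      rw [norm_mul, Complex.norm_I, one_mul, Complex.norm_cpow_real, Complex.norm_real,
        Real.norm_of_nonneg (le_of_lt hε)]
    have h2 := (h0.const_add (((lam : ℝ) ^ β : ℝ) : ℂ)).inv₀ (by simpa using ha)
    have h3 := h2.const_mul (((lam : ℝ) ^ β : ℝ) : ℂ)
    rw [add_zero, mul_inv_cancel₀ ha] at h3
    exact h3

/-- On the positive eigenspaces `1 / (a + z) = z⁻¹ (1 - a / (a + z))`. Compared with the full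
resolvent, the identity is replaced by the projection onto their closed span. -/
theorem exists_isSpectralSum (g : SmoothMetric n M) (W₁ W₂ : TopologicalSpace.Opens M)
    (hα : α ∈ Ioo (0 : ℝ) 1) (β : ℝ) {s : ℂ} (hs : 0 < s.re) :
    ∃ H : L2On g (W₁ : Set M) →L[ℂ] L2On g (W₂ : Set M), IsSpectralSum g α β W₁ W₂ s H ∧
      ∀ ξ, H ξ = (Complex.I * s ^ (α : ℂ))⁻¹ • (localPosProj g W₁ W₂ ξ -
        localResolventMul g β W₁ W₂ (Complex.I * s ^ (α : ℂ)) ξ) := by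
  have hV := orthogonalFamily_eigenspace g
  have hz := im_I_mul_cpow_pos hα hs
  have hz0 := I_mul_cpow_ne_zero hα hs
  have hb : ∀ lam : posEigenvalues g, ‖((((lam : ℝ) ^ β : ℝ) : ℂ) + Complex.I * s ^ (α : ℂ))⁻¹‖
      ≤ (Complex.I * s ^ (α : ℂ)).im⁻¹ := fun lam => norm_inv_ofReal_add_le hz
  obtain ⟨T, hT⟩ := exists_clm_spectralMul hV (inv_nonneg.2 hz.le) hb
  refine ⟨restr g W₂ ∘L T ∘L zeroExt g W₁, fun ξ => ?_, fun ξ => ?_⟩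
  · have h := ((summable_smul_starProjection_of_bound hV hb (zeroExt g W₁ ξ)).hasSum).mapL
      (restr g W₂)
    simp only [map_smul] at h
    rw [ContinuousLinearMap.comp_apply, ContinuousLinearMap.comp_apply, hT]
    exact h
  · rw [ContinuousLinearMap.comp_apply, ContinuousLinearMap.comp_apply, hT, localPosProj,
      localResolventMul, ← map_sub, ← map_smul]
    congr 1
    rw [resolventMul, spectralMul, spectralMul, spectralMul,
      ← (summable_smul_starProjection_of_bound hV (C := 1) (fun _ => by simp) _).tsum_sub
        (summable_smul_starProjection_of_bound hV (fun _ => norm_ofReal_div_add_le hz) _),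
      ← tsum_const_smul'']
    congr 1
    ext1 lam
    rw [← sub_smul, smul_smul]
    congr 1
    have h2 := ofReal_add_ne_zero (a := (lam : ℝ) ^ β) hz
    generalize Complex.I * s ^ (α : ℂ) = z at hz0 h2
    field_simp
    ring

end SourceToSolution

end FracSchrodinger

theorem proposition4p1 {n : ℕ} (hn : 2 ≤ n) {M : Type*} [TopologicalSpace M] [T2Space M]
    [CompactSpace M] [ConnectedSpace M] [ChartedSpace (EuclideanSpace ℝ (Fin n)) M]
    [IsManifold (𝓡 n) ∞ M] [MeasurableSpace M] [BorelSpace M]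
    (g g' : SmoothMetric n M) (W₁ W₂ : TopologicalSpace.Opens M)
    (hW₁ : (W₁ : Set M).Nonempty) (hW₂ : (W₂ : Set M).Nonempty)
    {α β β' : ℝ} (hα : α ∈ Ioo (0 : ℝ) 1) (hβ : β ∈ Ioo (0 : ℝ) 1) (hβ' : β' ∈ Ioo (0 : ℝ) 1)
    (hL : ∀ (f : ℝ → L2On g (W₁ : Set M)) (f' : ℝ → L2On g' (W₁ : Set M)),
      IsC2c f → IsC2c f' → (∀ t, SameFun (f t) (f' t)) →
      ∀ t, SameFun (sourceToSolution g α β W₁ W₂ f t) (sourceToSolution g' α β' W₁ W₂ f' t))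
    (s : ℂ) (hs : 0 < s.re) :
    ∃ (H : L2On g (W₁ : Set M) →L[ℂ] L2On g (W₂ : Set M))
      (H' : L2On g' (W₁ : Set M) →L[ℂ] L2On g' (W₂ : Set M)),
      IsSpectralSum g α β W₁ W₂ s H ∧ IsSpectralSum g' α β' W₁ W₂ s H' ∧
      ∀ ξ ξ', SameFun ξ ξ' → SameFun (H ξ) (H' ξ') := by
  obtain ⟨H, hH, eH⟩ := exists_isSpectralSum g W₁ W₂ hα β hs
  obtain ⟨H', hH', eH'⟩ := exists_isSpectralSum g' W₁ W₂ hα β' hs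
  refine ⟨H, H', hH, hH', fun ξ ξ' hξ => ?_⟩
  have hac : (vol g').restrict (W₂ : Set M) ≪ (vol g).restrict (W₂ : Set M) :=
    (vol_absolutelyContinuous g' g).restrict _
  have hac' : (vol g).restrict (W₂ : Set M) ≪ (vol g').restrict (W₂ : Set M) :=
    (vol_absolutelyContinuous g g').restrict _
  let S := sameFunSubmodule hac hac'
  -- Agreement at real `s = ε > 0` passes to the limit `ε → 0+`, as the set of matching pairs is
  -- closed.
  have h1 : (localPosProj g W₁ W₂ ξ, localPosProj g' W₁ W₂ ξ') ∈ S := by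
    refine (isClosed_sameFunSubmodule hac hac').mem_of_tendsto
      ((tendsto_localResolventMul g W₁ W₂ hα β ξ).prodMk_nhds
        (tendsto_localResolventMul g' W₁ W₂ hα β' ξ')) ?_
    filter_upwards [self_mem_nhdsWithin] with ε hε
    exact sameFun_localResolventMul hα hL (s := ε) (by simpa using hε) hξ
  have h2 : (localResolventMul g β W₁ W₂ (Complex.I * s ^ (α : ℂ)) ξ,
      localResolventMul g' β' W₁ W₂ (Complex.I * s ^ (α : ℂ)) ξ') ∈ S :=
    sameFun_localResolventMul hα hL hs hξ
  rw [eH, eH']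
  exact S.smul_mem _ (S.sub_mem h1 h2)
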